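/- **Setting.** For a finite alphabet $A$ (a finite nonempty set with the discrete topology), $A^{\mathbb Z}$ carries the product topology and the shift $(Sx)(i)=x(i+1)$; a *subshift* is a closed set $X\subseteq A^{\mathbb Z}$ with $S(X)=X$. Systems $(X,T)$ and $(Y,R)$ ($T,R$ homeomorphisms) are *conjugate* if there is a homeomorphism $\varphi:X\to Y$ with $\varphi\circ T=R\circ\varphi$; a subshift $X$ is *conjugate to its inverse* if $(X,S)$ and $(X,S^{-1})$ are conjugate. A sequence $x\in A^{\mathbb Z}$ is a *Toeplitz sequence* if for every $i\in\mathbb Z$ there is $p\ge 1$ with $x(i+kp)=x(i)$ for all $k\in\mathbb Z$; a *Toeplitz subshift* is the closure of the orbit $\{S^kx:k\in\mathbb Z\}$ of a Toeplitz sequence $x$. A *directive sequence* $\boldsymbol\tau=(\tau_n:A_{n+1}^*\to A_n^*)_{n\ge 0}$ is a sequence of non-erasing morphisms of free monoids over finite alphabets; put $\tau_{[n,N)}=\tau_n\circ\cdots\circ\tau_{N-1}$ for $N>n$. Let $X^{(n)}_{\boldsymbol\tau}$ be the set of $x\in A_n^{\mathbb Z}$ each of whose finite subwords occurs in $\tau_{[n,N)}(a)$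 for some $N>n$, $a\in A_N$. The subshift $X^{(0)}_{\boldsymbol\tau}$ is the *$\mathcal S$-adic subshift generated by* $\boldsymbol\tau$. The sequence $\boldsymbol\tau$ is *constant-length* if, for each $n$, $|\tau_n(a)|$ does not depend on $a\in A_{n+1}$; *primitive* if for every $n$ there is $N>n$ such that every letter of $A_n$ occurs in $\tau_{[n,N)}(a)$ for every $a\in A_N$; *proper* if for each $n$ all words $\tau_n(a)$, $a\in A_{n+1}$, start with the same letter and end with the same letter; *recognizable* if for each $n$ and each $x\in A_n^{\mathbb Z}$ there is at most one pair $(y,k)$ with $y\in X^{(n+1)}_{\boldsymbol\tau}$, $0\le k<|\tau_n(y(0))|$ and $x=S^k\tau_n(y)$, where $\tau_n(y)=\cdots\tau_n(y(-1)).\tau_n(y(0))\tau_n(y(1))\cdots$ (the dot marks position $0$). Its *alphabet rank* is $\liminf_n|A_n|$. A *strong Toeplitz subshift of rank $2$* is a subshift conjugate to an $\mathcal S$-adic subshift generated by a constant-length, primitive, proper and recognizable directive sequence of alphabet rank at most $2$. Let $\boldsymbol S$ be the space of all subshifts with some finite alphabet $A\subseteq\mathbb Z$, with the metric $d(X,Y)=2^{-\inf\{n\in\mathbb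 N:\ L_n(X)\ne L_n(Y)\}}$ (and $d(X,X)=0$), where $L_n(X)$ is the set of words of length $n$ occurring in elements of $X$. Let $\boldsymbol M\subseteq\boldsymbol S$ be the subspace of all infinite minimal subshifts (minimal: every orbit is dense). A subset of $\boldsymbol M$ is *generic* if it contains a dense $G_\delta$ subset of $\boldsymbol M$, and *meager* if it is contained in a countable union of nowhere dense subsets of $\boldsymbol M$. **Theorem.** 1. The set of all strong Toeplitz subshifts of rank $2$ in $\boldsymbol M$ which are not conjugate to their inverses is generic in $\boldsymbol M$. 2. The set of all Toeplitz subshifts in $\boldsymbol M$ which are not conjugate to their inverses is generic in $\boldsymbol M$. 3. The set of all Toeplitz subshifts in $\boldsymbol M$ which are conjugate to their inverses is meager in $\boldsymbol M$. -/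

import Mathlib

noncomputable section

namespace ToeplitzShift

open SymbolicDynamics.FullShift

/-! ### Topological dynamical systems and subshifts -/

/-- Two homeomorphisms `T : X → X` and `S : Y → Y` are conjugate if some homeomorphism
`φ : X → Y` satisfies `φ ∘ T = S ∘ φ`. -/
def Conjugate {X Y : Type*} [TopologicalSpace X] [TopologicalSpace Y]
    (T : X ≃ₜ X) (S : Y ≃ₜ Y) : Prop :=
  ∃ φ : X ≃ₜ Y, ∀ x, φ (T x) = S (φ x)

/-- The shift `(S x) i = x (i + 1)` as a homeomorphism of a two-sided subshift. -/
def shiftHomeo {A : Type*} [TopologicalSpace A] (X : Subshift A ℤ) :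
    X.carrier ≃ₜ X.carrier where
  toFun x := ⟨shift 1 x.1, X.mapsTo 1 x.2⟩
  invFun x := ⟨shift (-1) x.1, X.mapsTo (-1) x.2⟩
  left_inv x := by
    apply Subtype.ext
    funext i
    simp
  right_inv x := by
    apply Subtype.ext
    funext i
    simp
  continuous_toFun :=
    ((continuous_shift (1 : ℤ)).comp continuous_subtype_val).subtype_mk _
  continuous_invFun :=
    ((continuous_shift (-1 : ℤ)).comp continuous_subtype_val).subtype_mk _

/-- `(X, S)` is conjugate to its inverse `(X, S⁻¹)`. -/
def ConjugateToInverse {A : Type*} [TopologicalSpace A] (X : Subshift A ℤ) : Prop :=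
  Conjugate (shiftHomeo X) (shiftHomeo X).symm

/-- The orbit of a bi-infinite word under the shift and its inverse. -/
def orbit {A : Type*} (x : ℤ → A) : Set (ℤ → A) :=
  Set.range fun k : ℤ => shift k x

/-- Every orbit is dense in `X`. -/
def IsMinimalSubshift {A : Type*} [TopologicalSpace A] (X : Subshift A ℤ) : Prop :=
  ∀ x ∈ X.carrier, closure (orbit x) = X.carrier

/-- A Toeplitz sequence: every position is periodic. -/
def IsToeplitzSequence {A : Type*} (x : ℤ → A) : Prop :=
  ∀ i : ℤ, ∃ p : ℕ, 1 ≤ p ∧ ∀ k : ℤ, x (i + k * p) = x i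

/-- A Toeplitz subshift: the orbit closure of a Toeplitz sequence. -/
def IsToeplitz {A : Type*} [TopologicalSpace A] (X : Subshift A ℤ) : Prop :=
  ∃ x : ℤ → A, IsToeplitzSequence x ∧ X.carrier = closure (orbit x)

/-- The subword `x[i, i + n)`. -/
def word {A : Type*} (x : ℤ → A) (i : ℤ) (n : ℕ) : List A :=
  List.ofFn fun j : Fin n => x (i + (j : ℕ))

/-- `L_n(X)`: the words of length `n` that occur in some element of `X`. -/
def lang {A : Type*} [TopologicalSpace A] (X : Subshift A ℤ) (n : ℕ) : Set (List A) :=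
  {w | ∃ x ∈ X.carrier, ∃ i : ℤ, w = word x i n}

/-! ### `S`-adic subshifts -/

/-- The starting position of the block `σ (y i)` in the bi-infinite concatenation
`⋯ σ(y(-2)) σ(y(-1)) . σ(y(0)) σ(y(1)) ⋯`, where the dot marks position `0`. -/
def cut {A B : Type*} (σ : A → List B) (y : ℤ → A) (i : ℤ) : ℤ :=
  (∑ j ∈ Finset.Ico 0 i, ((σ (y j)).length : ℤ)) -
    ∑ j ∈ Finset.Ico i 0, ((σ (y j)).length : ℤ)

/-- `z` is the image `⋯ σ(y(-1)) . σ(y(0)) σ(y(1)) ⋯` of `y` under the morphism determined by the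
letter images `σ`. For a non-erasing morphism there is exactly one such `z`. -/
def IsImage {A B : Type*} (σ : A → List B) (y : ℤ → A) (z : ℤ → B) : Prop :=
  ∀ (i : ℤ) (j : ℕ) (h : j < (σ (y i)).length), z (cut σ y i + j) = (σ (y i))[j]

/-- `(y, k)` is a centered `σ`-representation of `x`: `x = S^k σ(y)` and `0 ≤ k < |σ(y(0))|`. -/
def IsCenteredRep {A B : Type*} (σ : A → List B) (x : ℤ → B) (y : ℤ → A) (k : ℤ) : Prop :=
  (∃ z, IsImage σ y z ∧ x = shift k z) ∧ 0 ≤ k ∧ k < (σ (y 0)).length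

/-- `σ` is recognizable in `Y`: every `x` has at most one centered `σ`-representation in `Y`. -/
def IsRecognizableIn {A B : Type*} (σ : A → List B) (Y : Set (ℤ → A)) : Prop :=
  ∀ (x : ℤ → B) (y y' : ℤ → A) (k k' : ℤ), y ∈ Y → y' ∈ Y →
    IsCenteredRep σ x y k → IsCenteredRep σ x y' k' → y = y' ∧ k = k'

/-- A directive sequence of non-erasing morphisms `A (n + 1)* → A n*` between finite (nonempty)
discrete alphabets. A morphism of free monoids is given by its values on letters, and extends to
words by `fun w => w.flatMap (τ n)`. -/
structure DirectiveSequence where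
  A : ℕ → Type
  [instFintype : ∀ n, Fintype (A n)]
  [instNonempty : ∀ n, Nonempty (A n)]
  [instTop : ∀ n, TopologicalSpace (A n)]
  [instDiscrete : ∀ n, DiscreteTopology (A n)]
  τ : ∀ n, A (n + 1) → List (A n)
  nonerasing : ∀ n a, τ n a ≠ []

attribute [instance] DirectiveSequence.instFintype DirectiveSequence.instNonempty
  DirectiveSequence.instTop DirectiveSequence.instDiscrete

namespace DirectiveSequence

variable (D : DirectiveSequence)

/-- The composition `τ_{[n, n + j)} = τ_n ∘ ⋯ ∘ τ_{n + j - 1}` on letters. -/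
def comp (n : ℕ) : (j : ℕ) → D.A (n + j) → List (D.A n)
  | 0, a => [a]
  | j + 1, a => (D.τ (n + j) a).flatMap (comp n j)

/-- `L^{(n)}`: the words that occur in `τ_{[n, N)}(a)` for some `N > n` and some letter `a`. -/
def language (n : ℕ) : Set (List (D.A n)) :=
  {w | ∃ j, 0 < j ∧ ∃ a : D.A (n + j), w <:+: D.comp n j a}

/-- `X^{(n)}`: the bi-infinite words all of whose finite subwords are subwords of elements of
`L^{(n)}`. -/
def level (n : ℕ) : Subshift (D.A n) ℤ where
  carrier := {x | ∀ (i : ℤ) (m : ℕ), ∃ w ∈ D.language n, word x i m <:+: w}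
  isClosed := by
    simp only [Set.ofPred_forall]
    refine isClosed_iInter fun i => isClosed_iInter fun m => ?_
    have hc : Continuous fun (x : ℤ → D.A n) (j : Fin m) => x (i + (j : ℕ)) := by fun_prop
    exact (isClosed_discrete
      {f : Fin m → D.A n | ∃ w ∈ D.language n, List.ofFn f <:+: w}).preimage hc
  mapsTo g x hx i m := by
    have h : word (shift g x) i m = word x (g + i) m := by
      simp [word, shift, add_assoc]
    rw [h]
    exact hx (g + i) m

/-- The `S`-adic subshift generated by the directive sequence. -/
def subshift : Subshift (D.A 0) ℤ := D.level 0

/-- Each morphism `τ n` has constant length. -/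
def ConstantLength : Prop :=
  ∀ n, ∃ l : ℕ, ∀ a, (D.τ n a).length = l

/-- For every `n` there is `N = n + j > n` such that every letter of `A n` occurs in
`τ_{[n, N)}(a)` for every letter `a` of `A N`. -/
def Primitive : Prop :=
  ∀ n, ∃ j, 0 < j ∧ ∀ (b : D.A n) (a : D.A (n + j)), b ∈ D.comp n j a

/-- For each `n`, all words `τ n a` start with the same letter and end with the same letter. -/
def Proper : Prop :=
  ∀ n, ∃ p q : D.A n, ∀ a, (D.τ n a).head? = some p ∧ (D.τ n a).getLast? = some q

/-- Each `τ n` is recognizable in `X^{(n + 1)}`. -/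
def Recognizable : Prop :=
  ∀ n, IsRecognizableIn (D.τ n) (D.level (n + 1)).carrier

/-- The alphabet rank `liminf |A n|`, possibly infinite. -/
def alphabetRank : ℕ∞ :=
  Filter.liminf (fun n => (Fintype.card (D.A n) : ℕ∞)) Filter.atTop

end DirectiveSequence

/-- A strong Toeplitz subshift of rank `K`: it is conjugate to an `S`-adic subshift generated by a
constant-length, primitive, proper and recognizable directive sequence of alphabet rank at most
`K`. -/
def IsStrongToeplitz {A : Type*} [TopologicalSpace A] (K : ℕ) (X : Subshift A ℤ) : Prop :=
  ∃ D : DirectiveSequence, D.ConstantLength ∧ D.Primitive ∧ D.Proper ∧ D.Recognizable ∧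
    D.alphabetRank ≤ K ∧ Conjugate (shiftHomeo X) (shiftHomeo D.subshift)

/-! ### The space of subshifts -/

/-- The set `S` of all subshifts over some finite alphabet `F ⊆ ℤ`. -/
def SubshiftSpace : Type :=
  {X : Subshift ℤ ℤ // ∃ F : Finset ℤ, ∀ x ∈ X.carrier, ∀ i, x i ∈ F}

theorem carrier_subset_of_lang_eq {X Y : Subshift ℤ ℤ} (h : ∀ n, lang X n = lang Y n) :
    X.carrier ⊆ Y.carrier := by
  intro x hx
  rw [← Y.isClosed.closure_eq, mem_closure_iff]
  intro U hU hxU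
  obtain ⟨I, u, hu, hIU⟩ := isOpen_pi_iff.1 hU x hxU
  let m : ℕ := I.sup Int.natAbs
  have hm : word x (-m) (2 * m + 1) ∈ lang Y (2 * m + 1) := by
    rw [← h]
    exact ⟨x, hx, _, rfl⟩
  obtain ⟨y, hy, i, hw⟩ := hm
  refine ⟨shift (i + m) y, hIU ?_, Y.mapsTo _ hy⟩
  intro j hj
  have hjm : j.natAbs ≤ m := Finset.le_sup (f := Int.natAbs) hj
  have hf := List.ofFn_injective hw
  have hlt : (j + m).toNat < 2 * m + 1 := by omega
  have hval := congrFun hf ⟨(j + m).toNat, hlt⟩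
  have hcast : (((j + m).toNat : ℕ) : ℤ) = j + m := by omega
  simp only [hcast] at hval
  have e1 : -(m : ℤ) + (j + m) = j := by ring
  have e2 : i + (j + m) = i + m + j := by ring
  rw [e1, e2] at hval
  rw [shift_apply, ← hval]
  exact (hu j hj).2

theorem SubshiftSpace.ext_lang {X Y : SubshiftSpace} (h : ∀ n, lang X.1 n = lang Y.1 n) :
    X = Y := by
  have hc : X.1.carrier = Y.1.carrier :=
    (carrier_subset_of_lang_eq h).antisymm (carrier_subset_of_lang_eq fun n => (h n).symm)
  apply Subtype.ext
  revert hc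
  rcases X.1 with ⟨_, _, _⟩
  rcases Y.1 with ⟨_, _, _⟩
  rintro rfl
  rfl

/-- The metric `d(X, Y) = 2 ^ (-inf {n | L_n(X) ≠ L_n(Y)})`, with `d(X, X) = 0`. -/
def langDist (X Y : SubshiftSpace) : ℝ :=
  open Classical in
  if X = Y then 0 else (1 / 2 : ℝ) ^ sInf {n : ℕ | lang X.1 n ≠ lang Y.1 n}

theorem langDist_nonneg (X Y : SubshiftSpace) : 0 ≤ langDist X Y := by
  unfold langDist
  split_ifs <;> positivity

theorem langDist_triangle (X Y Z : SubshiftSpace) :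
    langDist X Z ≤ langDist X Y + langDist Y Z := by
  by_cases hXY : X = Y
  · subst hXY
    have : langDist X X = 0 := by simp [langDist]
    simp [this]
  by_cases hYZ : Y = Z
  · subst hYZ
    have : langDist Y Y = 0 := by simp [langDist]
    simp [this]
  by_cases hXZ : X = Z
  · have : langDist X Z = 0 := by simp [langDist, hXZ]
    rw [this]
    exact add_nonneg (langDist_nonneg _ _) (langDist_nonneg _ _)
  have hne : {n : ℕ | lang X.1 n ≠ lang Z.1 n}.Nonempty := by
    by_contra hcon
    rw [Set.not_nonempty_iff_eq_empty, Set.eq_empty_iff_forall_notMem] at hcon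
    exact hXZ (SubshiftSpace.ext_lang fun n => by simpa using hcon n)
  have hmem := Nat.sInf_mem hne
  set n := sInf {n : ℕ | lang X.1 n ≠ lang Z.1 n} with hn
  have hd : langDist X Z = (1 / 2 : ℝ) ^ n := by simp [langDist, hXZ, hn]
  by_cases h1 : lang X.1 n = lang Y.1 n
  · have h2 : lang Y.1 n ≠ lang Z.1 n := fun h => hmem (h1.trans h)
    have hle : langDist X Z ≤ langDist Y Z := by
      rw [hd, langDist, if_neg hYZ]
      exact pow_le_pow_of_le_one (by norm_num) (by norm_num) (Nat.sInf_le h2)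
    linarith [langDist_nonneg X Y]
  · have hle : langDist X Z ≤ langDist X Y := by
      rw [hd, langDist, if_neg hXY]
      exact pow_le_pow_of_le_one (by norm_num) (by norm_num) (Nat.sInf_le h1)
    linarith [langDist_nonneg Y Z]

instance : MetricSpace SubshiftSpace where
  dist := langDist
  dist_self X := by simp [langDist]
  dist_comm X Y := by
    by_cases h : X = Y
    · simp [langDist, h]
    · simp only [langDist, if_neg h, if_neg (Ne.symm h), ne_comm (a := lang X.1 _)]
  dist_triangle := langDist_triangle
  eq_of_dist_eq_zero {X Y} h := by
    by_contra hne
    have h' : langDist X Y = 0 := h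
    rw [langDist, if_neg hne] at h'
    exact absurd h' (by positivity)

/-- The space `M` of all infinite minimal subshifts, with the topology induced from `S`. -/
def M : Set SubshiftSpace :=
  {X | X.1.carrier.Infinite ∧ IsMinimalSubshift X.1}

/-- A set is generic if it contains a dense `G_δ` set. -/
def IsGeneric {X : Type*} [TopologicalSpace X] (s : Set X) : Prop :=
  ∃ t ⊆ s, IsGδ t ∧ Dense t

end ToeplitzShift

end

noncomputable section

namespace ToeplitzShift

open SymbolicDynamics.FullShift

/-! All three statements follow from one dense $G_\delta$ set: the $X \in M$ that have an asymmetric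
level of every parameter $q$. Such a level is a clopen base $c$ of a cyclic partition of $X$ of
period $p \ge q$. Its elements share the window $[-q,q)$, and each begins with one of two blocks $u,
v$ of length $p$. Cut into blocks from the base, a point has its occurrences of $v$ at mutual
distance at least $10$; the pattern of $v$ at $0, 10, 30$ occurs, and its mirror image $0, 20, 30$
does not.

Openness for fixed $q$: the definition inspects only a bounded window, hence only finitely much of
the language (`IsAsymmetricLevel.of_lang_eq`).

Density: an infinite minimal $X$ has return words $a, b$ to a word of length $n$ with $ab \ne ba$.
Substituting $ab$ and $ba$ for the letters of a fixed Toeplitz sequence keeps the words of length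
$n$, because both concatenations consist of return words. The Toeplitz sequence `skeleton` carries
the pattern $10, 20, 40$ modulo $100$ and a copy of itself at the residue $40$, so the asymmetry
appears at all scales (`exists_hasAsymmetricLevel_lang_eq`).

No reversal: a conjugacy to the inverse is a reflection composed with a local rule. When $p$ exceeds
the radius, the rule reads at most four consecutive blocks, and isolation of $v$ forces it to move
every $v$ by one fixed offset and reflect it. It would thus create the forbidden mirror pattern
(`not_conjugateToInverse`).

Strong Toeplitz of rank 2: the shared windows allow levels to be nested after translation
(`IsLevel.exists_next`). A point common to all bases is Toeplitz, and cutting the blocks of one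
level into those of the preceding one gives the directive sequence, with at most two letters from
level $1$ on. -/

/-! ### Agreement on central windows -/

/-- `x` and `y` agree on the window `[-N, N]`. -/
def Agree {A : Type*} (N : ℤ) (x y : ℤ → A) : Prop :=
  ∀ i, -N ≤ i → i ≤ N → x i = y i

theorem Agree.symm {A : Type*} {N : ℤ} {x y : ℤ → A} (h : Agree N x y) : Agree N y x :=
  fun i h1 h2 => (h i h1 h2).symm

theorem Agree.trans {A : Type*} {N : ℤ} {x y z : ℤ → A} (h : Agree N x y) (h' : Agree N y z) :
    Agree N x z :=
  fun i h1 h2 => (h i h1 h2).trans (h' i h1 h2)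

theorem Agree.mono {A : Type*} {M N : ℤ} {x y : ℤ → A} (h : Agree N x y) (hMN : M ≤ N) :
    Agree M x y :=
  fun i h1 h2 => h i (by omega) (by omega)

theorem Agree.shift {A : Type*} {M N k : ℤ} {x y : ℤ → A} (h : Agree N x y)
    (hk : M + |k| ≤ N) : Agree M (shift k x) (shift k y) := by
  intro i h1 h2
  have := abs_le.1 (le_refl |k|)
  exact h (k + i) (by omega) (by omega)

theorem shift_shift {A : Type*} (a b : ℤ) (x : ℤ → A) : shift a (shift b x) = shift (a + b) x := by
  rw [add_comm, shift_add]

theorem isOpen_agree {A : Type*} [TopologicalSpace A] [DiscreteTopology A] (N : ℤ) (x : ℤ → A) :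
    IsOpen {y | Agree N x y} := by
  have h : {y | Agree N x y} = cylinder (Finset.Icc (-N) N) x := by
    ext y
    simp only [Agree, Set.mem_ofPred_eq, mem_cylinder, Finset.mem_Icc, and_imp]
    exact forall_congr' fun i => by simp only [eq_comm]
  rw [h]
  exact isOpen_cylinder _ _

theorem exists_agree_subset {A : Type*} [TopologicalSpace A] {U : Set (ℤ → A)} (hU : IsOpen U)
    {x : ℤ → A} (hx : x ∈ U) : ∃ N, {y | Agree N x y} ⊆ U := by
  obtain ⟨I, u, hu, hIU⟩ := isOpen_pi_iff.1 hU x hx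
  refine ⟨(I.sup Int.natAbs : ℕ), fun y hy => hIU fun j hj => ?_⟩
  have hjm : j.natAbs ≤ I.sup Int.natAbs := Finset.le_sup (f := Int.natAbs) hj
  rw [← hy j (by omega) (by omega)]
  exact (hu j hj).2

theorem mem_closure_iff_agree {A : Type*} [TopologicalSpace A] [DiscreteTopology A]
    {T : Set (ℤ → A)} {x : ℤ → A} : x ∈ closure T ↔ ∀ N, ∃ y ∈ T, Agree N x y := by
  rw [mem_closure_iff]
  constructor
  · intro h N
    obtain ⟨y, hy, hyT⟩ := h _ (isOpen_agree N x) (fun i _ _ => rfl)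
    exact ⟨y, hyT, hy⟩
  · intro h U hU hx
    obtain ⟨N, hN⟩ := exists_agree_subset hU hx
    obtain ⟨y, hyT, hy⟩ := h N
    exact ⟨y, hN hy, hyT⟩

theorem isOpen_not_agree {A : Type*} [TopologicalSpace A] [DiscreteTopology A] (N : ℤ) :
    IsOpen {z : (ℤ → A) × (ℤ → A) | ¬ Agree N z.1 z.2} := by
  have h : {z : (ℤ → A) × (ℤ → A) | ¬ Agree N z.1 z.2} =
      ⋃ i ∈ Set.Icc (-N) N, {z : (ℤ → A) × (ℤ → A) | z.1 i ≠ z.2 i} := by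
    ext z
    simp [Agree, and_assoc]
  rw [h]
  refine isOpen_biUnion fun i _ => ?_
  have hc : Continuous fun z : (ℤ → A) × (ℤ → A) => (z.1 i, z.2 i) := by fun_prop
  exact (isOpen_discrete {q : A × A | q.1 ≠ q.2}).preimage hc

/-- A compact family of pairs of distinct sequences is separated by a uniform window. -/
theorem exists_forall_not_agree {A : Type*} [TopologicalSpace A] [DiscreteTopology A]
    {K : Set ((ℤ → A) × (ℤ → A))} (hK : IsCompact K) (h : ∀ z ∈ K, z.1 ≠ z.2) :
    ∃ N : ℕ, ∀ z ∈ K, ¬ Agree N z.1 z.2 := by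
  obtain ⟨N, hN⟩ := hK.elim_directed_cover
    (fun N : ℕ => {z : (ℤ → A) × (ℤ → A) | ¬ Agree N z.1 z.2})
    (fun N => isOpen_not_agree N) (by
      intro z hz
      obtain ⟨i, hi⟩ := Function.ne_iff.1 (h z hz)
      simp only [Set.mem_iUnion]
      exact ⟨i.natAbs, fun hA => hi (hA i (by omega) (by omega))⟩)
    (directed_of_isDirected_le fun M N hMN z hz hA => hz (hA.mono (by exact_mod_cast hMN)))
  exact ⟨N, fun z hz => hN hz⟩

/-! ### Subshifts over finite alphabets -/

theorem isCompact_carrier {A : Type*} [TopologicalSpace A] {X : Subshift A ℤ} {F : Finset A}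
    (hF : ∀ x ∈ X.carrier, ∀ i, x i ∈ F) : IsCompact X.carrier := by
  refine (isCompact_univ_pi fun _ : ℤ => F.finite_toSet.isCompact).of_isClosed_subset
    X.isClosed fun x hx i _ => hF x hx i

theorem IsMinimalSubshift.exists_agree_shift {A : Type*} [TopologicalSpace A] [DiscreteTopology A]
    {X : Subshift A ℤ} (hX : IsMinimalSubshift X) {x y : ℤ → A} (hx : x ∈ X.carrier)
    (hy : y ∈ X.carrier) (N : ℤ) : ∃ k, Agree N y (shift k x) := by
  rw [← hX x hx] at hy
  obtain ⟨_, ⟨k, rfl⟩, h⟩ := mem_closure_iff_agree.1 hy N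
  exact ⟨k, h⟩

/-- Uniform recurrence: in a minimal subshift every word occurs with bounded gaps. -/
theorem IsMinimalSubshift.exists_recurrence {A : Type*} [TopologicalSpace A] [DiscreteTopology A]
    {X : Subshift A ℤ} (hX : IsMinimalSubshift X) (hc : IsCompact X.carrier) (N : ℤ) :
    ∃ R : ℕ, ∀ x ∈ X.carrier, ∀ y ∈ X.carrier, ∃ t : ℤ, 0 ≤ t ∧ t ≤ R ∧
      Agree N y (shift t x) := by
  obtain ⟨R, hR⟩ := (hc.prod hc).elim_directed_cover
    (fun R : ℕ => {z : (ℤ → A) × (ℤ → A) | ∃ t : ℤ, -R ≤ t ∧ t ≤ R ∧ Agree N z.2 (shift t z.1)})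
    (fun R => by
      have h : {z : (ℤ → A) × (ℤ → A) | ∃ t : ℤ, -R ≤ t ∧ t ≤ R ∧ Agree N z.2 (shift t z.1)} =
          ⋃ t ∈ Set.Icc (-R : ℤ) R, ⋂ i ∈ Finset.Icc (-N) N,
            {z : (ℤ → A) × (ℤ → A) | z.2 i = z.1 (t + i)} := by
        ext z
        simp [Agree, and_assoc]
      rw [h]
      refine isOpen_biUnion fun t _ => isOpen_biInter_finset fun i _ => ?_
      have hc : Continuous fun z : (ℤ → A) × (ℤ → A) => (z.2 i, z.1 (t + i)) := by fun_prop
      exact (isOpen_discrete {q : A × A | q.1 = q.2}).preimage hc)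
    (by
      rintro ⟨x, y⟩ ⟨hx, hy⟩
      obtain ⟨k, hk⟩ := hX.exists_agree_shift hx hy N
      simp only [Set.mem_iUnion]
      exact ⟨k.natAbs, k, by omega, by omega, hk⟩)
    (directed_of_isDirected_le fun M N hMN z ⟨t, h1, h2, h3⟩ =>
      ⟨t, by omega, by omega, h3⟩)
  -- The cover yields times in $[-R,R]$; applying it to $S^R x$ makes them nonnegative, at the price
  -- of the bound $2R$.
  refine ⟨2 * R, fun x hx y hy => ?_⟩
  obtain ⟨t, h1, h2, h3⟩ := hR (show (shift (R : ℤ) x, y) ∈ _ from ⟨X.mapsTo _ hx, hy⟩)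
  refine ⟨t + R, by omega, by push_cast; omega, ?_⟩
  rwa [shift_shift] at h3

/-! ### Windows and languages -/

theorem word_eq_word_iff {A : Type*} {x y : ℤ → A} {i j : ℤ} {n : ℕ} :
    word x i n = word y j n ↔ ∀ k : ℤ, 0 ≤ k → k < n → x (i + k) = y (j + k) := by
  unfold word
  rw [List.ofFn_injective.eq_iff, funext_iff]
  constructor
  · intro h k h0 hk
    have := h ⟨k.toNat, by omega⟩
    simpa [Int.toNat_of_nonneg h0] using this
  · intro h k
    exact h k (by omega) (by exact_mod_cast k.2)

theorem exists_agree_of_lang_eq {A : Type*} [TopologicalSpace A] {X Y : Subshift A ℤ} {N : ℕ}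
    (h : lang X (2 * N + 1) = lang Y (2 * N + 1)) {y : ℤ → A} (hy : y ∈ Y.carrier) :
    ∃ x ∈ X.carrier, Agree N x y := by
  have hm : word y (-N) (2 * N + 1) ∈ lang X (2 * N + 1) := by
    rw [h]
    exact ⟨y, hy, _, rfl⟩
  obtain ⟨x, hx, i, hw⟩ := hm
  rw [word_eq_word_iff] at hw
  refine ⟨shift (i + N) x, X.mapsTo _ hx, fun j h1 h2 => ?_⟩
  have := hw (j + N) (by omega) (by push_cast; omega)
  rw [shift_apply, show i + N + j = i + (j + N) by ring, ← this]
  congr 1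
  ring

theorem lang_eq_of_le {A : Type*} [TopologicalSpace A] {X Y : Subshift A ℤ} {m n : ℕ}
    (hmn : m ≤ n) (h : lang X n = lang Y n) : lang X m = lang Y m := by
  have key : ∀ {X Y : Subshift A ℤ}, lang X n = lang Y n → lang X m ⊆ lang Y m := by
    rintro X Y h _ ⟨x, hx, i, rfl⟩
    have : word x i n ∈ lang Y n := by
      rw [← h]
      exact ⟨x, hx, i, rfl⟩
    obtain ⟨y, hy, j, hw⟩ := this
    refine ⟨y, hy, j, ?_⟩
    rw [word_eq_word_iff] at hw ⊢
    exact fun k h0 hk => hw k h0 (by omega)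
  exact (key h).antisymm (key h.symm)

theorem lang_eq_of_dist_lt {X Y : SubshiftSpace} {n : ℕ} (h : dist X Y < (1 / 2 : ℝ) ^ n) :
    lang X.1 n = lang Y.1 n := by
  change langDist X Y < _ at h
  by_cases hXY : X = Y
  · rw [hXY]
  rw [langDist, if_neg hXY] at h
  by_contra hne
  exact absurd (pow_le_pow_of_le_one (by norm_num) (by norm_num)
    (Nat.sInf_le (s := {n : ℕ | lang X.1 n ≠ lang Y.1 n}) hne)) (not_le.2 h)

theorem dist_le_of_lang_eq {X Y : SubshiftSpace} {n : ℕ} (h : lang X.1 n = lang Y.1 n) :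
    dist X Y ≤ (1 / 2 : ℝ) ^ n := by
  change langDist X Y ≤ _
  by_cases hXY : X = Y
  · rw [langDist, if_pos hXY]
    positivity
  rw [langDist, if_neg hXY]
  refine pow_le_pow_of_le_one (by norm_num) (by norm_num) ?_
  have hne : {n : ℕ | lang X.1 n ≠ lang Y.1 n}.Nonempty := by
    by_contra hcon
    rw [Set.not_nonempty_iff_eq_empty, Set.eq_empty_iff_forall_notMem] at hcon
    exact hXY (SubshiftSpace.ext_lang fun n => by simpa using hcon n)
  by_contra hlt
  exact Nat.sInf_mem hne (lang_eq_of_le (not_le.1 hlt).le h)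

theorem isOpen_of_lang {s : Set M}
    (h : ∀ X ∈ s, ∃ n : ℕ, ∀ Y : M, lang X.1.1 n = lang Y.1.1 n → Y ∈ s) : IsOpen s := by
  rw [Metric.isOpen_iff]
  intro X hX
  obtain ⟨n, hn⟩ := h X hX
  refine ⟨(1 / 2 : ℝ) ^ n, by positivity, fun Y hY => hn Y ?_⟩
  exact (lang_eq_of_dist_lt (Metric.mem_ball.1 hY)).symm

theorem dense_of_lang {s : Set M}
    (h : ∀ (X : M) (n : ℕ), ∃ Y ∈ s, lang X.1.1 n = lang Y.1.1 n) : Dense s := by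
  rw [Metric.dense_iff]
  intro X r hr
  obtain ⟨n, hn⟩ := exists_pow_lt_of_lt_one hr (show (1 / 2 : ℝ) < 1 by norm_num)
  obtain ⟨Y, hYs, hY⟩ := h X n
  exact ⟨Y, Metric.mem_ball.2 ((dist_le_of_lang_eq hY.symm).trans_lt hn), hYs⟩

/-! ### Levels: clopen bases of periodic partitions -/

/-- The set `c`, which depends on the window `[-m, m]` only, meets `X` in the base of a partition
`X = ⨆ S^i (X ∩ c)`, `0 ≤ i < p`, with `S^p (X ∩ c) = X ∩ c`. -/
structure IsLevel (X : Subshift ℤ ℤ) (p m : ℕ) (c : Set (ℤ → ℤ)) : Prop where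
  pos : 0 < p
  mem_of_agree : ∀ x y, Agree m x y → x ∈ c → y ∈ c
  cover : ∀ x ∈ X.carrier, ∃ i : ℤ, 0 ≤ i ∧ i < p ∧ shift i x ∈ c
  shift_mem : ∀ x ∈ X.carrier, x ∈ c → shift (p : ℤ) x ∈ c
  shift_notMem : ∀ x ∈ X.carrier, x ∈ c → ∀ i : ℤ, 0 < i → i < p → shift i x ∉ c

namespace IsLevel

variable {X : Subshift ℤ ℤ} {p m : ℕ} {c : Set (ℤ → ℤ)}

theorem shift_neg_mem (h : IsLevel X p m c) {x : ℤ → ℤ} (hx : x ∈ X.carrier) (hc : x ∈ c) :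
    shift (-p : ℤ) x ∈ c := by
  obtain ⟨i, h0, hi, hic⟩ := h.cover _ (X.mapsTo (-p : ℤ) hx)
  rcases h0.eq_or_lt with rfl | h0
  · rwa [shift_zero] at hic
  · exfalso
    have h1 := h.shift_notMem _ (X.mapsTo _ (X.mapsTo _ hx)) hic (p - i) (by omega) (by omega)
    rw [shift_shift, shift_shift] at h1
    apply h1
    convert hc using 1
    convert shift_zero x using 2
    ring

theorem shift_mul_mem (h : IsLevel X p m c) {x : ℤ → ℤ} (hx : x ∈ X.carrier) (hc : x ∈ c)
    (k : ℤ) : shift (k * p) x ∈ c := by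
  induction k using Int.induction_on with
  | zero => simpa using hc
  | succ k ih =>
    have := h.shift_mem _ (X.mapsTo _ hx) ih
    rw [shift_shift] at this
    convert this using 2
    ring
  | pred k ih =>
    have := h.shift_neg_mem (X.mapsTo _ hx) ih
    rw [shift_shift] at this
    convert this using 2
    ring

theorem shift_mem_iff (h : IsLevel X p m c) {x : ℤ → ℤ} (hx : x ∈ X.carrier) (hc : x ∈ c)
    (k : ℤ) : shift k x ∈ c ↔ (p : ℤ) ∣ k := by
  constructor
  · intro hk
    have hp : (0 : ℤ) < p := by exact_mod_cast h.pos
    have h1 := h.shift_mul_mem (X.mapsTo _ hx) hk (-(k / p))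
    rw [shift_shift, show -(k / p) * p + k = k % p by
      rw [Int.emod_def]
      ring] at h1
    by_contra hd
    have hne : k % p ≠ 0 := fun h0 => hd (Int.dvd_of_emod_eq_zero h0)
    have := Int.emod_nonneg k hp.ne'
    exact h.shift_notMem x hx hc _ (by omega) (Int.emod_lt_of_pos k hp) h1
  · rintro ⟨j, rfl⟩
    rw [mul_comm]
    exact h.shift_mul_mem hx hc j

theorem isClosed (h : IsLevel X p m c) : IsClosed (X.carrier ∩ c) := by
  refine X.isClosed.inter (isClosed_of_closure_subset fun x hx => ?_)
  obtain ⟨y, hy, hxy⟩ := mem_closure_iff_agree.1 hx m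
  exact h.mem_of_agree _ _ hxy.symm hy

/-- Agreement on $[-m,m]$ with a point of the base puts the shifted point in the base, so the return
time is a multiple of $p$. Hence $S^p$ is minimal on the base. -/
theorem exists_agree_shift_mul (h : IsLevel X p m c) (hX : IsMinimalSubshift X) {x y : ℤ → ℤ}
    (hx : x ∈ X.carrier) (hxc : x ∈ c) (hy : y ∈ X.carrier) (hyc : y ∈ c) (N : ℤ) :
    ∃ k : ℤ, Agree N y (shift (k * p) x) := by
  obtain ⟨k, hk⟩ := hX.exists_agree_shift hx hy (max N m)
  have hkc := h.mem_of_agree _ _ (hk.mono (le_max_right _ _)) hyc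
  obtain ⟨j, rfl⟩ := (h.shift_mem_iff hx hxc k).1 hkc
  exact ⟨j, by rw [mul_comm]; exact hk.mono (le_max_left _ _)⟩

end IsLevel

/-- The word `x[0, p)` is `v[0, p)`. -/
def IsBlock (p : ℕ) (v x : ℤ → ℤ) : Prop :=
  ∀ i : ℤ, 0 ≤ i → i < p → x i = v i

theorem IsBlock.of_agree {p : ℕ} {v x y : ℤ → ℤ} {k N : ℤ} (h : IsBlock p v (shift k x))
    (hxy : Agree N x y) (hk0 : 0 ≤ k) (hk : k + p ≤ N) : IsBlock p v (shift k y) := by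
  intro i h0 hi
  rw [← h i h0 hi]
  exact (hxy (k + i) (by omega) (by omega)).symm

/-- A level with at most two blocks `u` and `v`, whose elements share the window `[-q, q)`, and
such that the occurrences of `v` are isolated and contain a pattern but not its reversal. -/
structure IsAsymmetricLevel (X : Subshift ℤ ℤ) (q p m : ℕ) (c : Set (ℤ → ℤ))
    (u v w : ℤ → ℤ) : Prop extends IsLevel X p m c where
  le : q ≤ p
  eq_of_mem : ∀ x ∈ X.carrier, x ∈ c → ∀ i : ℤ, -q ≤ i → i < q → x i = w i
  block : ∀ x ∈ X.carrier, x ∈ c → IsBlock p u x ∨ IsBlock p v x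
  isolated : ∀ x ∈ X.carrier, x ∈ c → IsBlock p v x →
    ∀ j : ℤ, 0 < j → j < 10 → ¬ IsBlock p v (shift (j * p) x)
  occurs : ∃ x ∈ X.carrier, x ∈ c ∧ IsBlock p v x ∧ IsBlock p v (shift (10 * p : ℤ) x) ∧
    IsBlock p v (shift (30 * p : ℤ) x)
  avoids : ∀ x ∈ X.carrier, x ∈ c → ¬ (IsBlock p v x ∧ IsBlock p v (shift (20 * p : ℤ) x) ∧
    IsBlock p v (shift (30 * p : ℤ) x))

/-- `X` has an asymmetric level of parameter `q`. -/
def HasAsymmetricLevel (q : ℕ) (X : Subshift ℤ ℤ) : Prop :=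
  ∃ p m c u v w, IsAsymmetricLevel X q p m c u v w

/-- Membership in $c$, tested after shifts of at most $p$, reads within $m + p$ of the origin. The
blocks of index at most $30$ end before $40p$, and the common window reaches to $q$. Every clause
therefore transfers between points that agree up to $m + 40p + q$. -/
theorem IsAsymmetricLevel.of_lang_eq {X Y : Subshift ℤ ℤ} {q p m : ℕ} {c : Set (ℤ → ℤ)}
    {u v w : ℤ → ℤ} (h : IsAsymmetricLevel X q p m c u v w)
    (hXY : lang X (2 * (m + 40 * p + q) + 1) = lang Y (2 * (m + 40 * p + q) + 1)) :
    IsAsymmetricLevel Y q p m c u v w := by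
  have key : ∀ y ∈ Y.carrier, ∃ x ∈ X.carrier, Agree (m + 40 * p + q : ℕ) x y :=
    fun y hy => exists_agree_of_lang_eq hXY hy
  have mem : ∀ {x y : ℤ → ℤ}, Agree (m + 40 * p + q : ℕ) x y → ∀ i : ℤ, 0 ≤ i → i ≤ p →
      shift i x ∈ c → shift i y ∈ c := fun {x y} hxy i h0 hi hx =>
    h.mem_of_agree _ _ (hxy.shift (by rw [abs_of_nonneg h0]; push_cast; omega)) hx
  have mem0 : ∀ {x y : ℤ → ℤ}, Agree (m + 40 * p + q : ℕ) x y → x ∈ c → y ∈ c :=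
    fun {x y} hxy hx => h.mem_of_agree _ _ (hxy.mono (by push_cast; omega)) hx
  have block : ∀ {x y : ℤ → ℤ} {b : ℤ → ℤ}, Agree (m + 40 * p + q : ℕ) x y → ∀ j : ℤ, 0 ≤ j →
      j ≤ 30 → IsBlock p b (shift (j * p) x) → IsBlock p b (shift (j * p) y) :=
    fun {x y b} hxy j h0 hj hx => hx.of_agree hxy (by positivity) (by push_cast; nlinarith)
  have block0 : ∀ {x y : ℤ → ℤ} {b : ℤ → ℤ}, Agree (m + 40 * p + q : ℕ) x y →
      IsBlock p b x → IsBlock p b y :=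
    fun {x y b} hxy hx => by simpa using block hxy 0 le_rfl (by norm_num) (by simpa using hx)
  refine ⟨⟨h.pos, h.mem_of_agree, ?_, ?_, ?_⟩, h.le, ?_, ?_, ?_, ?_, ?_⟩
  · intro y hy
    obtain ⟨x, hx, hxy⟩ := key y hy
    obtain ⟨i, h0, hi, hic⟩ := h.cover x hx
    exact ⟨i, h0, hi, mem hxy i h0 hi.le hic⟩
  · intro y hy hyc
    obtain ⟨x, hx, hxy⟩ := key y hy
    exact mem hxy p (by omega) le_rfl (h.shift_mem x hx (mem0 hxy.symm hyc))
  · intro y hy hyc i h0 hi hic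
    obtain ⟨x, hx, hxy⟩ := key y hy
    exact h.shift_notMem x hx (mem0 hxy.symm hyc) i h0 hi (mem hxy.symm i h0.le hi.le hic)
  · intro y hy hyc i h0 hi
    obtain ⟨x, hx, hxy⟩ := key y hy
    rw [← hxy i (by push_cast; omega) (by push_cast; omega)]
    exact h.eq_of_mem x hx (mem0 hxy.symm hyc) i h0 hi
  · intro y hy hyc
    obtain ⟨x, hx, hxy⟩ := key y hy
    exact (h.block x hx (mem0 hxy.symm hyc)).imp (block0 hxy) (block0 hxy)
  · intro y hy hyc hv j h0 hj hjv
    obtain ⟨x, hx, hxy⟩ := key y hy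
    exact h.isolated x hx (mem0 hxy.symm hyc) (block0 hxy.symm hv) j h0 hj
      (block hxy.symm j h0.le (by omega) hjv)
  · obtain ⟨x, hx, hxc, h0, h1, h2⟩ := h.occurs
    obtain ⟨y, hy, hyx⟩ := exists_agree_of_lang_eq hXY.symm hx
    have hxy := hyx.symm
    exact ⟨y, hy, mem0 hxy hxc, block0 hxy h0, block hxy 10 (by norm_num) (by norm_num) h1,
      block hxy 30 (by norm_num) (by norm_num) h2⟩
  · rintro y hy hyc ⟨h0, h1, h2⟩
    obtain ⟨x, hx, hxy⟩ := key y hy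
    have hyx := hxy.symm
    exact h.avoids x hx (mem0 hyx hyc) ⟨block0 hyx h0, block hyx 20 (by norm_num) (by norm_num) h1,
      block hyx 30 (by norm_num) (by norm_num) h2⟩

theorem isOpen_hasAsymmetricLevel (q : ℕ) : IsOpen {X : M | HasAsymmetricLevel q X.1.1} := by
  refine isOpen_of_lang ?_
  rintro X ⟨p, m, c, u, v, w, h⟩
  exact ⟨_, fun Y hXY => ⟨p, m, c, u, v, w, h.of_lang_eq hXY⟩⟩

/-! ### Subshifts which are not conjugate to their inverses -/

/-- A conjugacy from a subshift to its inverse is a sliding block code composed with a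
reflection. -/
theorem ConjugateToInverse.exists_reversing_code {X : Subshift ℤ ℤ} (h : ConjugateToInverse X)
    (hc : IsCompact X.carrier) :
    ∃ (Φ : (ℤ → ℤ) → (ℤ → ℤ)) (r : ℕ), (∀ x ∈ X.carrier, Φ x ∈ X.carrier) ∧
      (∀ x ∈ X.carrier, ∀ k : ℤ, Φ (shift k x) = shift (-k) (Φ x)) ∧
      ∀ x ∈ X.carrier, ∀ y ∈ X.carrier, ∀ s : ℤ,
        (∀ i, s - r ≤ i → i ≤ s + r → x i = y i) → Φ x (-s) = Φ y (-s) := by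
  classical
  obtain ⟨φ, hφ⟩ := h
  have hcs : CompactSpace X.carrier := isCompact_iff_compactSpace.1 hc
  have hpos : ∀ x : X.carrier, (φ ⟨shift 1 x.1, X.mapsTo 1 x.2⟩).1 = shift (-1) (φ x).1 :=
    fun x => congrArg Subtype.val (hφ x)
  have hneg : ∀ x : X.carrier, (φ ⟨shift (-1) x.1, X.mapsTo (-1) x.2⟩).1 = shift 1 (φ x).1 := by
    intro x
    have h1 := hpos ⟨shift (-1) x.1, X.mapsTo (-1) x.2⟩
    simp only [shift_shift, add_neg_cancel, shift_zero, Subtype.coe_eta] at h1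
    rw [h1, shift_shift, add_neg_cancel, shift_zero]
  have heq : ∀ (k : ℤ) (x : X.carrier),
      (φ ⟨shift k x.1, X.mapsTo k x.2⟩).1 = shift (-k) (φ x).1 := by
    intro k
    induction k using Int.induction_on with
    | zero => simp
    | succ k ih =>
      intro x
      have h1 := hpos ⟨shift k x.1, X.mapsTo _ x.2⟩
      rw [ih x] at h1
      simp only [shift_shift] at h1
      rw [neg_add_rev, ← h1]
      simp only [add_comm]
    | pred k ih =>
      intro x
      have h1 := hneg ⟨shift (-k) x.1, X.mapsTo _ x.2⟩
      rw [ih x] at h1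
      simp only [shift_shift] at h1
      rw [show -(-(k : ℤ) - 1) = 1 + -(-k) by ring, ← h1]
      congr 4
      ring
  -- The Curtis–Hedlund–Lyndon argument: pairs whose images differ at $0$ form a compact set off the
  -- diagonal, so one radius $r$ separates them all.
  have hK : IsCompact {z : X.carrier × X.carrier | (φ z.1).1 0 ≠ (φ z.2).1 0} := by
    refine IsClosed.isCompact ?_
    have hcont : Continuous fun z : X.carrier × X.carrier => ((φ z.1).1 0, (φ z.2).1 0) := by
      have h0 : Continuous fun x : X.carrier => (φ x).1 0 :=
        (continuous_apply 0).comp (continuous_subtype_val.comp φ.continuous)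
      exact (h0.comp continuous_fst).prodMk (h0.comp continuous_snd)
    exact (isClosed_discrete {q : ℤ × ℤ | q.1 ≠ q.2}).preimage hcont
  obtain ⟨r, hr⟩ := exists_forall_not_agree
    (hK.image (f := fun z : X.carrier × X.carrier => (z.1.1, z.2.1)) (by fun_prop)) (by
      rintro _ ⟨z, hz, rfl⟩ hzz
      exact hz (by rw [Subtype.ext hzz]))
  -- The value outside $X$ is arbitrary; all three properties concern points of $X$ only.
  refine ⟨fun x => if hx : x ∈ X.carrier then (φ ⟨x, hx⟩).1 else x, r, ?_, ?_, ?_⟩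
  · intro x hx
    simp only [dif_pos hx]
    exact (φ _).2
  · intro x hx k
    simp only [dif_pos hx, dif_pos (X.mapsTo k hx)]
    exact heq k ⟨x, hx⟩
  · intro x hx y hy s hxy
    simp only [dif_pos hx, dif_pos hy]
    by_contra hne
    refine hr _ ⟨(⟨shift s x, X.mapsTo s hx⟩, ⟨shift s y, X.mapsTo s hy⟩), ?_, rfl⟩ ?_
    · have e1 := congrFun (heq s ⟨x, hx⟩) 0
      have e2 := congrFun (heq s ⟨y, hy⟩) 0
      simp only [shift_apply, add_zero] at e1 e2
      change (φ _).1 0 ≠ (φ _).1 0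
      rw [e1, e2]
      exact hne
    · intro i h1 h2
      exact hxy (s + i) (by omega) (by omega)

/-- The reversing code acts on sequences of blocks. Isolation lets it see at most one $v$ at a time,
so it can only reflect the set of positions of $v$ and translate it. -/
theorem not_conjugateToInverse {X : Subshift ℤ ℤ} (hX : IsMinimalSubshift X)
    (hc : IsCompact X.carrier) (hG : ∀ q, HasAsymmetricLevel q X) : ¬ ConjugateToInverse X := by
  intro hinv
  obtain ⟨Φ, r, hΦX, hΦ, hloc⟩ := hinv.exists_reversing_code hc
  -- The parameter $r + 1$ ensures that the radius $r$ is smaller than the block length $p$.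
  obtain ⟨p, m, c, u, v, w, h⟩ := hG (r + 1)
  have hpos := h.pos
  have hle := h.le
  obtain ⟨x₀, hx₀, hx₀c, hv0, hv1, hv2⟩ := h.occurs
  obtain ⟨c₀, hc0, hcp, hc₀⟩ := h.cover _ (hΦX _ hx₀)
  -- The translation by $c_0 < p$ makes the code preserve the base: first at $x_0$, then everywhere
  -- by locality and minimality of $S^p$ on the base.
  set Ψ : (ℤ → ℤ) → (ℤ → ℤ) := fun x => shift c₀ (Φ x) with hΨ
  have hΨX : ∀ x ∈ X.carrier, Ψ x ∈ X.carrier := fun x hx => X.mapsTo _ (hΦX x hx)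
  have hΨshift : ∀ x ∈ X.carrier, ∀ k : ℤ, Ψ (shift k x) = shift (-k) (Ψ x) := by
    intro x hx k
    simp only [hΨ, hΦ x hx, shift_shift, add_comm]
  have hΨloc : ∀ x ∈ X.carrier, ∀ y ∈ X.carrier, ∀ t : ℤ,
      (∀ i, -t - c₀ - r ≤ i → i ≤ -t - c₀ + r → x i = y i) → Ψ x t = Ψ y t := by
    intro x hx y hy t hxy
    have := hloc x hx y hy (-t - c₀) hxy
    simpa [hΨ, add_comm] using this
  have hΨc : ∀ x ∈ X.carrier, x ∈ c → Ψ x ∈ c := by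
    intro x hx hxc
    obtain ⟨k, hk⟩ := h.exists_agree_shift_mul hX hx₀ hx₀c hx hxc (m + p + r)
    have h1 : Ψ (shift (k * p) x₀) ∈ c := by
      rw [hΨshift _ hx₀, ← neg_mul]
      exact h.shift_mul_mem (hΨX _ hx₀) hc₀ _
    refine h.mem_of_agree _ _ (fun t h1 h2 => ?_) h1
    refine hΨloc _ (X.mapsTo _ hx₀) _ hx _ fun i h3 h4 => ?_
    exact (hk i (by omega) (by omega)).symm
  set V : (ℤ → ℤ) → ℤ → Prop := fun x i => IsBlock p v (shift (i * p) x) with hV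
  have hVshift : ∀ x k i, V (shift (k * p) x) i ↔ V x (k + i) := by
    intro x k i
    simp only [hV, shift_shift]
    rw [show i * (p : ℤ) + k * p = (k + i) * p by ring]
  have hiso : ∀ x ∈ X.carrier, x ∈ c → ∀ i j, V x i → i < j → j < i + 10 → ¬ V x j := by
    intro x hx hxc i j hi hij hji hj
    have := h.isolated _ (X.mapsTo _ hx) (h.shift_mul_mem hx hxc i) hi (j - i) (by omega) (by omega)
    apply this
    rw [shift_shift]
    convert hj using 3
    ring
  have heqblock : ∀ x ∈ X.carrier, x ∈ c → ∀ y ∈ X.carrier, y ∈ c → ∀ i, (V x i ↔ V y i) →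
      ∀ t : ℤ, i * p ≤ t → t < i * p + p → x t = y t := by
    intro x hx hxc y hy hyc i hi t h1 h2
    have e : ∀ b z, IsBlock p b (shift (i * p) z) → z t = b (t - i * p) := by
      intro b z hz
      rw [← hz (t - i * p) (by omega) (by omega), shift_apply]
      congr 1
      ring
    rcases h.block _ (X.mapsTo _ hx) (h.shift_mul_mem hx hxc i) with hxu | hxv
    · rcases h.block _ (X.mapsTo _ hy) (h.shift_mul_mem hy hyc i) with hyu | hyv
      · rw [e u x hxu, e u y hyu]
      · rw [e v x (hi.2 hyv), e v y hyv]
    · rw [e v x hxv, e v y (hi.1 hxv)]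
  -- For $0 \le t < p$ the coordinates read lie between $-t-c_0-r > -3p$ and $r < p$, hence in the
  -- blocks $-3, \dots, 0$.
  have hcode₀ : ∀ x ∈ X.carrier, x ∈ c → ∀ y ∈ X.carrier, y ∈ c →
      (∀ d : ℤ, -3 ≤ d → d ≤ 0 → (V x d ↔ V y d)) → V (Ψ x) 0 → V (Ψ y) 0 := by
    intro x hx hxc y hy hyc hd hVx i h0 hi
    rw [← hVx i h0 hi]
    simp only [zero_mul, shift_zero]
    refine hΨloc _ hy _ hx _ fun t h1 h2 => ?_
    have hp : (0 : ℤ) < p := by exact_mod_cast hpos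
    have h3 := Int.emod_nonneg t hp.ne'
    have h4 := Int.emod_lt_of_pos t hp
    have h5 := Int.emod_add_mul_ediv t p
    have h6 : -3 ≤ t / p := (Int.le_ediv_iff_mul_le hp).2 (by omega)
    have h7 : t / p < 1 := (Int.ediv_lt_iff_lt_mul hp).2 (by omega)
    rw [mul_comm] at h5
    exact heqblock _ hy hyc _ hx hxc (t / p) (hd _ h6 (by omega)).symm t (by omega) (by omega)
  have hcode : ∀ x ∈ X.carrier, x ∈ c → ∀ y ∈ X.carrier, y ∈ c → ∀ i j : ℤ,
      (∀ d : ℤ, -3 ≤ d → d ≤ 0 → (V x (i + d) ↔ V y (j + d))) → V (Ψ x) (-i) → V (Ψ y) (-j) := by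
    intro x hx hxc y hy hyc i j hd hVx
    have h1 := hcode₀ _ (X.mapsTo (i * p) hx) (h.shift_mul_mem hx hxc i) _ (X.mapsTo (j * p) hy)
      (h.shift_mul_mem hy hyc j) (by simpa only [hVshift] using hd)
    rw [hΨshift _ hx, hΨshift _ hy, ← neg_mul, ← neg_mul, hVshift, hVshift] at h1
    simpa using h1 (by simpa using hVx)
  have hV0 : V x₀ 0 := by simpa [hV] using hv0
  have hnear : ∀ i : ℤ, -10 < i → i < 10 → (V x₀ i ↔ i = 0) := by
    intro i h1 h2
    constructor
    · intro hi
      by_contra hne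
      rcases lt_or_gt_of_ne hne with hlt | hgt
      · exact hiso x₀ hx₀ hx₀c i 0 hi hlt (by omega) hV0
      · exact hiso x₀ hx₀ hx₀c 0 i hV0 hgt (by omega) hi
    · rintro rfl
      exact hV0
  have hΨ₀ : Ψ x₀ ∈ X.carrier := hΨX _ hx₀
  -- a window without `v` never produces a `v`
  have hzero : ∀ x ∈ X.carrier, x ∈ c → ∀ i : ℤ,
      (∀ d : ℤ, -3 ≤ d → d ≤ 0 → ¬ V x (i + d)) → ¬ V (Ψ x) (-i) := by
    intro x hx hxc i hi hVi
    -- The windows of $x_0$ ending at the blocks $4$ and $5$ also avoid $v$, since its only $v$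
    -- nearby is at $0$. They would both produce a $v$, at adjacent positions of $\Psi x_0$.
    have h4 := hcode x hx hxc x₀ hx₀ hx₀c i 4 (fun d h1 h2 => by
      rw [hnear _ (by omega) (by omega)]
      exact iff_of_false (hi d h1 h2) (by omega)) hVi
    have h5 := hcode x hx hxc x₀ hx₀ hx₀c i 5 (fun d h1 h2 => by
      rw [hnear _ (by omega) (by omega)]
      exact iff_of_false (hi d h1 h2) (by omega)) hVi
    exact hiso _ hΨ₀ hc₀ (-5) (-4) h5 (by omega) (by omega) h4
  have hone : ∀ x ∈ X.carrier, x ∈ c → ∀ i : ℤ, V x i → ∀ d : ℤ, 0 ≤ d → d ≤ 3 →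
      ∀ e : ℤ, -3 ≤ e → e ≤ 0 → (V x (i + d + e) ↔ V x₀ (d + e)) := by
    intro x hx hxc i hi d h1 h2 e h3 h4
    rw [hnear _ (by omega) (by omega)]
    constructor
    · intro hVi
      by_contra hne
      rcases lt_or_gt_of_ne hne with hlt | hgt
      · exact hiso x hx hxc (i + d + e) i hVi (by omega) (by omega) hi
      · exact hiso x hx hxc i (i + d + e) hi (by omega) (by omega) hVi
    · intro h0
      rwa [add_assoc, h0, add_zero]
  -- Some offset $d$ must produce a $v$: a window of four blocks contains no $v$ or looks like a
  -- window of $x_0$ around $0$, so otherwise $\Psi x_0$ would contain no $v$ at all, against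
  -- minimality.
  obtain ⟨d, hd0, hd3, hd⟩ : ∃ d : ℤ, 0 ≤ d ∧ d ≤ 3 ∧ V (Ψ x₀) (-d) := by
    by_contra! hcon
    have hnone : ∀ i : ℤ, ¬ V (Ψ x₀) (-i) := by
      intro i hVi
      by_cases hw : ∀ d : ℤ, -3 ≤ d → d ≤ 0 → ¬ V x₀ (i + d)
      · exact hzero x₀ hx₀ hx₀c i hw hVi
      · push Not at hw
        obtain ⟨d, h1, h2, hVd⟩ := hw
        refine hcon (-d) (by omega) (by omega)
          (hcode x₀ hx₀ hx₀c x₀ hx₀ hx₀c i (-d) (fun e h3 h4 => ?_) hVi)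
        have := hone x₀ hx₀ hx₀c (i + d) hVd (-d) (by omega) (by omega) e h3 h4
        rwa [add_neg_cancel_right] at this
    obtain ⟨k, hk⟩ := h.exists_agree_shift_mul hX hΨ₀ hc₀ hx₀ hx₀c (p : ℤ)
    apply hnone (-k)
    rw [neg_neg]
    have := IsBlock.of_agree (k := 0) (by simpa using hv0) hk le_rfl (by omega)
    simpa [hV] using this
  have htrans : ∀ i : ℤ, V x₀ i → V (Ψ x₀) (-(i + d)) := fun i hi =>
    hcode x₀ hx₀ hx₀c x₀ hx₀ hx₀c d (i + d)
      (fun e h3 h4 => (hone x₀ hx₀ hx₀c i hi d hd0 hd3 e h3 h4).symm) hd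
  -- The $v$ at $0, 10, 30$ in $x_0$ become $v$ at $-d, -10-d, -30-d$. Seen from $-30-d$ these are
  -- $30, 20, 0$.
  refine h.avoids _ (X.mapsTo (-(30 + d) * p) hΨ₀) (h.shift_mul_mem hΨ₀ hc₀ _) ⟨?_, ?_, ?_⟩
  · exact htrans 30 hv2
  · have := htrans 10 hv1
    rw [shift_shift]
    convert this using 2
    ring
  · have := htrans 0 hV0
    rw [shift_shift]
    convert this using 2
    ring

/-! ### Nested sequences of levels -/

/-- A nested sequence of levels of `X` with two blocks each, such that the elements of each base
share a window containing the two blocks of the preceding level around the origin. -/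
structure LevelSequence (X : Subshift ℤ ℤ) where
  p : ℕ → ℕ
  m : ℕ → ℕ
  c : ℕ → Set (ℤ → ℤ)
  isLevel : ∀ n, IsLevel X (p n) (m n) (c n)
  p_zero : p 0 = 1
  c_zero : c 0 = Set.univ
  lt : ∀ n, p n < p (n + 1)
  subset : ∀ n, ∀ x ∈ X.carrier, x ∈ c (n + 1) → x ∈ c n
  window : ∀ n, ∃ w : ℤ → ℤ, ∀ x ∈ X.carrier, x ∈ c (n + 1) →
    ∀ i : ℤ, -p n ≤ i → i < p n → x i = w i
  block : ∀ n, ∃ u v : ℤ → ℤ, ∀ x ∈ X.carrier, x ∈ c (n + 1) →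
    IsBlock (p (n + 1)) u x ∨ IsBlock (p (n + 1)) v x

/-- The elements of an asymmetric base of large parameter look alike near the origin, so they all
have the same phase $j$ relative to the given level. Translating that base by $j$ puts it inside the
given one. -/
theorem IsLevel.exists_next {X : Subshift ℤ ℤ} (hne : X.carrier.Nonempty)
    (hG : ∀ q, HasAsymmetricLevel q X) {p m : ℕ} {c : Set (ℤ → ℤ)} (h : IsLevel X p m c) :
    ∃ (p' m' : ℕ) (c' : Set (ℤ → ℤ)), IsLevel X p' m' c' ∧ p < p' ∧
      (∀ x ∈ X.carrier, x ∈ c' → x ∈ c) ∧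
      (∃ w : ℤ → ℤ, ∀ x ∈ X.carrier, x ∈ c' → ∀ i : ℤ, -p ≤ i → i < p → x i = w i) ∧
      ∃ u v : ℤ → ℤ, ∀ x ∈ X.carrier, x ∈ c' → IsBlock p' u x ∨ IsBlock p' v x := by
  -- After a translation by $j < p$, the common window must still contain $[-m,m]$, to decide
  -- membership in $c$, and $[-p,p)$.
  obtain ⟨p', m', c', u, v, w, h'⟩ := hG (m + 3 * p)
  have hp := h.pos
  have hp' := h'.le
  obtain ⟨x₁, hx₁⟩ := hne
  obtain ⟨i₁, -, -, hi₁⟩ := h'.cover x₁ hx₁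
  have hx₀ := X.mapsTo i₁ hx₁
  obtain ⟨j, hj0, hj, hjc⟩ := h.cover _ hx₀
  refine ⟨p', m' + p, {x | shift (-j) x ∈ c'}, ⟨h'.pos, ?_, ?_, ?_, ?_⟩, by omega, ?_, ?_, ?_⟩
  · intro x y hxy hx
    refine h'.mem_of_agree _ _ (hxy.shift ?_) hx
    rw [abs_neg, abs_of_nonneg hj0]
    push_cast
    omega
  · intro x hx
    obtain ⟨i, h0, hi, hic⟩ := h'.cover _ (X.mapsTo (-j) hx)
    refine ⟨i, h0, hi, ?_⟩
    rw [shift_shift] at hic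
    rwa [Set.mem_ofPred_eq, shift_shift, add_comm]
  · intro x hx hxc
    have := h'.shift_mem _ (X.mapsTo (-j) hx) hxc
    rw [shift_shift] at this
    rwa [Set.mem_ofPred_eq, shift_shift, add_comm]
  · intro x hx hxc i h0 hi hic
    refine h'.shift_notMem _ (X.mapsTo (-j) hx) hxc i h0 hi ?_
    rw [Set.mem_ofPred_eq, shift_shift] at hic
    rwa [shift_shift, add_comm]
  · intro x hx hxc
    have hA : Agree m (shift j (shift i₁ x₁)) (shift j (shift (-j) x)) := by
      intro i h1 h2
      rw [shift_apply, shift_apply j,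
        h'.eq_of_mem _ hx₀ hi₁ (j + i) (by push_cast; omega) (by push_cast; omega),
        h'.eq_of_mem _ (X.mapsTo (-j) hx) hxc (j + i) (by push_cast; omega) (by push_cast; omega)]
    have := h.mem_of_agree _ _ hA hjc
    rwa [shift_shift, add_neg_cancel, shift_zero] at this
  · refine ⟨shift j w, fun x hx hxc i h1 h2 => ?_⟩
    rw [shift_apply, ← h'.eq_of_mem _ (X.mapsTo (-j) hx) hxc (j + i) (by push_cast; omega)
      (by push_cast; omega), shift_apply, neg_add_cancel_left]
  -- A translated block is the end of an old block followed by the first $j$ letters of the next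
  -- one. These belong to the common window $w$, so there are still at most two blocks.
  · have key : ∀ b x : ℤ → ℤ, x ∈ X.carrier → shift (-j) x ∈ c' → IsBlock p' b (shift (-j) x) →
        IsBlock p' (fun i => if j + i < p' then b (j + i) else w (j + i - p')) x := by
      intro b x hx hxc hb i h0 hi
      dsimp only
      split_ifs with hji
      · rw [← hb (j + i) (by omega) hji, shift_apply, neg_add_cancel_left]
      · rw [← h'.eq_of_mem _ (X.mapsTo _ (X.mapsTo (-j) hx)) (h'.shift_mem _ (X.mapsTo _ hx) hxc)
          (j + i - p') (by push_cast; omega) (by push_cast; omega), shift_apply, shift_apply]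
        congr 1
        ring
    refine ⟨_, _, fun x hx hxc => (h'.block _ (X.mapsTo (-j) hx) hxc).imp (key u x hx hxc)
      (key v x hx hxc)⟩

theorem exists_levelSequence {X : Subshift ℤ ℤ} (hne : X.carrier.Nonempty)
    (hG : ∀ q, HasAsymmetricLevel q X) : Nonempty (LevelSequence X) := by
  let State := {s : ℕ × ℕ × Set (ℤ → ℤ) // IsLevel X s.1 s.2.1 s.2.2}
  have h₀ : IsLevel X 1 0 Set.univ :=
    ⟨one_pos, fun _ _ _ _ => trivial, fun x _ => ⟨0, le_rfl, by norm_num, trivial⟩,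
      fun _ _ _ => trivial, fun x _ _ i h1 h2 => by push_cast at h2; omega⟩
  have hnext : ∀ s : State, ∃ s' : State, s.1.1 < s'.1.1 ∧
      (∀ x ∈ X.carrier, x ∈ s'.1.2.2 → x ∈ s.1.2.2) ∧
      (∃ w : ℤ → ℤ, ∀ x ∈ X.carrier, x ∈ s'.1.2.2 →
        ∀ i : ℤ, -s.1.1 ≤ i → i < s.1.1 → x i = w i) ∧
      ∃ u v : ℤ → ℤ, ∀ x ∈ X.carrier, x ∈ s'.1.2.2 →
        IsBlock s'.1.1 u x ∨ IsBlock s'.1.1 v x := by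
    rintro ⟨⟨p, m, c⟩, h⟩
    obtain ⟨p', m', c', h', hrest⟩ := h.exists_next hne hG
    exact ⟨⟨⟨p', m', c'⟩, h'⟩, hrest⟩
  choose next hnext using hnext
  let s : ℕ → State := fun n => Nat.rec ⟨⟨1, 0, Set.univ⟩, h₀⟩ (fun _ s => next s) n
  exact ⟨⟨fun n => (s n).1.1, fun n => (s n).1.2.1, fun n => (s n).1.2.2, fun n => (s n).2, rfl,
    rfl, fun n => (hnext (s n)).1, fun n => (hnext (s n)).2.1, fun n => (hnext (s n)).2.2.1,
    fun n => (hnext (s n)).2.2.2⟩⟩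

namespace LevelSequence

variable {X : Subshift ℤ ℤ} (L : LevelSequence X)

/-- The base of the `n`-th level. -/
def base (n : ℕ) : Set (ℤ → ℤ) := X.carrier ∩ L.c n

theorem base_zero : L.base 0 = X.carrier := by simp [base, L.c_zero]

theorem base_succ_subset (n : ℕ) : L.base (n + 1) ⊆ L.base n :=
  fun x hx => ⟨hx.1, L.subset n x hx.1 hx.2⟩

theorem base_subset {n k : ℕ} (h : n ≤ k) : L.base k ⊆ L.base n :=
  antitone_nat_of_succ_le (f := L.base) L.base_succ_subset h

theorem base_nonempty (hne : X.carrier.Nonempty) (n : ℕ) : (L.base n).Nonempty := by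
  obtain ⟨x, hx⟩ := hne
  obtain ⟨i, -, -, hi⟩ := (L.isLevel n).cover x hx
  exact ⟨_, X.mapsTo i hx, hi⟩

theorem shift_mem_base {n : ℕ} {x : ℤ → ℤ} (hx : x ∈ L.base n) (k : ℤ) :
    shift (k * L.p n) x ∈ L.base n :=
  ⟨X.mapsTo _ hx.1, (L.isLevel n).shift_mul_mem hx.1 hx.2 k⟩

theorem dvd_of_shift_mem_base {n : ℕ} {x : ℤ → ℤ} (hx : x ∈ L.base n) {k : ℤ}
    (hk : shift k x ∈ L.base n) : (L.p n : ℤ) ∣ k :=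
  ((L.isLevel n).shift_mem_iff hx.1 hx.2 k).1 hk.2

theorem strictMono_p : StrictMono L.p := strictMono_nat_of_lt_succ L.lt

theorem p_pos (n : ℕ) : 0 < L.p n := (L.isLevel n).pos

theorem p_dvd (hne : X.carrier.Nonempty) {n k : ℕ} (h : n ≤ k) : L.p n ∣ L.p k := by
  obtain ⟨x, hx⟩ := L.base_nonempty hne k
  have h1 := L.base_subset h (L.shift_mem_base hx 1)
  have h2 := L.dvd_of_shift_mem_base (L.base_subset h hx) h1
  rw [one_mul] at h2
  exact_mod_cast h2

/-- By compactness the bases have a common point. Its returns to the base of level $n + 1$, at all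
multiples of the period, repeat its coordinates in $[-p_n, p_n)$. -/
theorem isToeplitz (L : LevelSequence X) (hX : IsMinimalSubshift X) (hc : IsCompact X.carrier)
    (hne : X.carrier.Nonempty) : IsToeplitz X := by
  obtain ⟨x, hx⟩ := IsCompact.nonempty_iInter_of_sequence_nonempty_isCompact_isClosed L.base
    L.base_succ_subset (L.base_nonempty hne) (by rwa [L.base_zero])
    (fun n => (L.isLevel n).isClosed)
  rw [Set.mem_iInter] at hx
  refine ⟨x, fun i => ?_, (hX x (hx 0).1).symm⟩
  obtain ⟨w, hw⟩ := L.window (i.natAbs + 1)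
  have hle : i.natAbs + 1 ≤ L.p (i.natAbs + 1) := L.strictMono_p.id_le _
  refine ⟨L.p (i.natAbs + 1 + 1), L.p_pos _, fun k => ?_⟩
  have h1 := L.shift_mem_base (hx (i.natAbs + 1 + 1)) k
  have h2 := hx (i.natAbs + 1 + 1)
  rw [hw x h2.1 h2.2 i (by omega) (by omega), ← hw _ h1.1 h1.2 i (by omega) (by omega),
    shift_apply, add_comm]

end LevelSequence

/-! ### Words of bi-infinite sequences -/

theorem length_word {A : Type*} (x : ℤ → A) (i : ℤ) (n : ℕ) : (word x i n).length = n := by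
  simp [word]

theorem getElem_word {A : Type*} (x : ℤ → A) (i : ℤ) (n k : ℕ) (h : k < (word x i n).length) :
    (word x i n)[k] = x (i + k) := by
  simp [word]

theorem word_add {A : Type*} (x : ℤ → A) (i : ℤ) (m n : ℕ) :
    word x i (m + n) = word x i m ++ word x (i + m) n := by
  apply List.ext_getElem
  · simp [length_word]
  · intro k h1 h2
    rw [getElem_word, List.getElem_append]
    split_ifs with h
    · rw [getElem_word]
    · rw [getElem_word]
      rw [length_word] at h ⊢
      congr 1
      omega

theorem word_one {A : Type*} (x : ℤ → A) (i : ℤ) : word x i 1 = [x i] := by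
  simp [word]

theorem word_infix_word {A : Type*} (x : ℤ → A) {i j : ℤ} {m n : ℕ} (h1 : j ≤ i)
    (h2 : i + m ≤ j + n) : word x i m <:+: word x j n := by
  obtain ⟨a, rfl⟩ := Int.le.dest h1
  obtain ⟨b, rfl⟩ : ∃ b, n = a + m + b := ⟨n - (a + m), by omega⟩
  rw [word_add, word_add]
  exact ⟨_, _, rfl⟩

theorem exists_eq_word_of_infix {A : Type*} {x : ℤ → A} {j : ℤ} {n : ℕ} {w : List A}
    (h : w <:+: word x j n) : ∃ i, w = word x i w.length := by
  obtain ⟨a, b, hab⟩ := h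
  refine ⟨j + a.length, List.ext_getElem (by simp [length_word]) fun k h1 h2 => ?_⟩
  have hlen := congrArg List.length hab
  rw [length_word] at hlen
  simp only [List.length_append] at hlen
  have h3 : a.length + k < (word x j n).length := by
    rw [length_word]
    omega
  have h4 := getElem_word x j n (a.length + k) h3
  simp only [← hab] at h4
  rw [getElem_word]
  simpa [h1, add_assoc] using h4

theorem flatMap_word {A B : Type*} {f : A → List B} {g : ℤ → A} {y : ℤ → B} {R : ℕ}
    (h : ∀ k, f (g k) = word y (k * R) R) (i : ℤ) (l : ℕ) :
    (word g i l).flatMap f = word y (i * R) (l * R) := by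
  induction l with
  | zero => simp [word]
  | succ l ih =>
    rw [word_add, word_one, List.flatMap_append, ih, List.flatMap_singleton, h, Nat.succ_mul,
      word_add]
    congr 2
    push_cast
    ring

theorem cut_of_constant_length {A B : Type*} {σ : A → List B} {l : ℕ}
    (h : ∀ a, (σ a).length = l) (y : ℤ → A) (i : ℤ) : cut σ y i = i * l := by
  simp only [cut, h, Finset.sum_const, Int.card_Ico, nsmul_eq_mul, ← sub_mul]
  congr 1
  omega

/-! ### The directive sequence of a nested sequence of levels -/

namespace LevelSequence

variable {X : Subshift ℤ ℤ} (L : LevelSequence X)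

/-- The words `x[0, p n)` for `x` in the base of level `n`. -/
def Letter (n : ℕ) : Type :=
  {f : Fin (L.p n) → ℤ // ∃ x ∈ L.base n, ∀ i, f i = x (i : ℕ)}

instance (n : ℕ) : TopologicalSpace (L.Letter n) := ⊥

instance (n : ℕ) : DiscreteTopology (L.Letter n) := ⟨rfl⟩

variable {L}

/-- The sequence of consecutive words of length `p n` in an element of the base of level `n`. -/
def code {n : ℕ} {x : ℤ → ℤ} (hx : x ∈ L.base n) (i : ℤ) : L.Letter n :=
  ⟨fun j => x (i * L.p n + (j : ℕ)), _, L.shift_mem_base hx i, fun _ => rfl⟩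

theorem code_eq_code_iff {n : ℕ} {x y : ℤ → ℤ} (hx : x ∈ L.base n) (hy : y ∈ L.base n)
    (i j : ℤ) : code hx i = code hy j ↔
      ∀ t : ℤ, 0 ≤ t → t < L.p n → x (i * L.p n + t) = y (j * L.p n + t) := by
  refine (Subtype.ext_iff (a1 := code hx i) (a2 := code hy j)).trans (funext_iff.trans ?_)
  constructor
  · intro h t h0 ht
    have := h ⟨t.toNat, by omega⟩
    simpa [code, Int.toNat_of_nonneg h0] using this
  · intro h t
    exact h t (by omega) (by exact_mod_cast t.2)

theorem exists_code_eq {n : ℕ} (a : L.Letter n) : ∃ x, ∃ hx : x ∈ L.base n, code hx 0 = a := by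
  obtain ⟨f, x, hx, hf⟩ := a
  exact ⟨x, hx, Subtype.ext (funext fun j => by simp [code, hf])⟩

theorem code_shift {n : ℕ} {x : ℤ → ℤ} (hx : x ∈ L.base n) (k i : ℤ) :
    code (L.shift_mem_base hx k) i = code hx (k + i) := by
  rw [code_eq_code_iff]
  intro t _ _
  rw [shift_apply]
  congr 1
  ring

theorem eq_of_code_eq {n : ℕ} {x y : ℤ → ℤ} (hx : x ∈ L.base n) (hy : y ∈ L.base n)
    (k l : ℤ) (h : ∀ i, code hx (k + i) = code hy (l + i)) :
    shift (k * L.p n) x = shift (l * L.p n) y := by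
  have hp : (0 : ℤ) < L.p n := by exact_mod_cast L.p_pos n
  funext t
  have h1 := (code_eq_code_iff hx hy _ _).1 (h (t / L.p n)) (t % L.p n)
    (Int.emod_nonneg t hp.ne') (Int.emod_lt_of_pos t hp)
  have h2 := Int.emod_add_mul_ediv t (L.p n)
  rw [shift_apply, shift_apply]
  convert h1 using 2
  · linear_combination -h2
  · linear_combination -h2

variable (L)

/-- The image of a letter of level `n + 1`: its decomposition into letters of level `n`. -/
def subst (n : ℕ) (a : L.Letter (n + 1)) : List (L.Letter n) :=
  word (code (L.base_succ_subset n (exists_code_eq a).choose_spec.choose)) 0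
    (L.p (n + 1) / L.p n)

variable {L}

/-- The representative chosen in `subst` is irrelevant: a letter of level $n + 1$ records all the
coordinates from which its letters of level $n$ are read. -/
theorem subst_code (hne : X.carrier.Nonempty) {n : ℕ} {x : ℤ → ℤ} (hx : x ∈ L.base (n + 1))
    (i : ℤ) : L.subst n (code hx i) =
      word (code (L.base_succ_subset n hx)) (i * (L.p (n + 1) / L.p n : ℕ))
        (L.p (n + 1) / L.p n) := by
  obtain ⟨l, hl⟩ := L.p_dvd hne (Nat.le_succ n)
  have hp := L.p_pos n
  rw [Nat.succ_eq_add_one] at hl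
  have hl' : L.p (n + 1) / L.p n = l := by rw [hl, Nat.mul_div_cancel_left _ hp]
  have hspec := (exists_code_eq (code hx i)).choose_spec.choose_spec
  rw [code_eq_code_iff] at hspec
  rw [subst, word_eq_word_iff, hl']
  intro k h0 hk
  rw [code_eq_code_iff]
  intro t ht0 ht
  have hle : k * (L.p n : ℤ) + t < L.p (n + 1) := by
    rw [hl]
    push_cast
    nlinarith
  have := hspec (k * L.p n + t) (by positivity) hle
  convert this using 2
  · ring
  · rw [hl]
    push_cast
    ring

theorem finite_letter {F : Finset ℤ} (hF : ∀ x ∈ X.carrier, ∀ i, x i ∈ F) (n : ℕ) :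
    Finite (L.Letter n) := by
  refine Finite.of_injective (β := Fin (L.p n) → F)
    (fun a i => ⟨a.1 i, ?_⟩) fun a b h => ?_
  · obtain ⟨x, hx, hax⟩ := a.2
    rw [hax]
    exact hF x hx.1 _
  · exact Subtype.ext (funext fun i => congrArg Subtype.val (congrFun h i))

variable (L)

/-- The directive sequence which decomposes the words of each level into those of the preceding
one. -/
abbrev directive (hne : X.carrier.Nonempty) {F : Finset ℤ} (hF : ∀ x ∈ X.carrier, ∀ i, x i ∈ F) :
    DirectiveSequence where
  A := L.Letter
  instFintype n := @Fintype.ofFinite _ (finite_letter hF n)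
  instNonempty n := ⟨code (L.base_nonempty hne n).choose_spec 0⟩
  τ := L.subst
  nonerasing n a := by
    rw [← List.length_pos_iff_ne_nil, subst, length_word]
    exact Nat.div_pos (L.lt n).le (L.p_pos n)

variable {L} (hne : X.carrier.Nonempty) {F : Finset ℤ} (hF : ∀ x ∈ X.carrier, ∀ i, x i ∈ F)

theorem comp_code (n j : ℕ) {x : ℤ → ℤ} (hx : x ∈ L.base (n + j)) (i : ℤ) :
    (L.directive hne hF).comp n j (code hx i) =
      word (code (L.base_subset (Nat.le_add_right n j) hx)) (i * (L.p (n + j) / L.p n : ℕ))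
        (L.p (n + j) / L.p n) := by
  induction j generalizing i with
  | zero =>
    have h1 : L.p (n + 0) / L.p n = 1 := Nat.div_self (L.p_pos n)
    rw [h1, word_one, Nat.cast_one, mul_one]
    rfl
  | succ j ih =>
    have hx' := L.base_succ_subset (n + j) hx
    have h1 := flatMap_word (fun k => ih hx' k)
      (i * (L.p (n + j + 1) / L.p (n + j) : ℕ)) (L.p (n + j + 1) / L.p (n + j))
    have h2 : L.p (n + j + 1) / L.p (n + j) * (L.p (n + j) / L.p n) = L.p (n + j + 1) / L.p n := by
      rw [Nat.div_mul_div_comm (L.p_dvd hne (Nat.le_succ _)) (L.p_dvd hne (Nat.le_add_right n j)),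
        mul_comm, Nat.mul_div_mul_left _ _ (L.p_pos (n + j))]
    rw [h2, mul_assoc, ← Nat.cast_mul, h2] at h1
    exact (congrArg (List.flatMap _) (subst_code hne hx i)).trans h1

/-- Every finite window of the code of an element of a base occurs in all blocks of a sufficiently
high level. -/
theorem exists_word_infix_comp (hX : IsMinimalSubshift X) (n m : ℕ) :
    ∃ j, 0 < j ∧ ∀ (x : ℤ → ℤ) (hx : x ∈ L.base n) (i : ℤ) (a : L.Letter (n + j)),
      word (code hx) i m <:+: (L.directive hne hF).comp n j a := by
  -- The summand `L.m n` forces occurrences to lie in the base, hence at multiples of $p_n$; the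
  -- other one covers the $m$ blocks.
  obtain ⟨R, hR⟩ := hX.exists_recurrence (isCompact_carrier hF) (L.m n + m * L.p n)
  have hp := L.p_pos n
  -- Since $p_{n+j} \ge n + j$, an occurrence that starts by time $R$ ends inside the block of level
  -- $n + j$.
  obtain ⟨j, hj⟩ : ∃ j, j = R + m * L.p n + 1 := ⟨_, rfl⟩
  refine ⟨j, by omega, fun x hx i a => ?_⟩
  obtain ⟨x₁, hx₁, rfl⟩ := exists_code_eq a
  rw [comp_code, zero_mul]
  have hx₁' := L.base_subset (Nat.le_add_right n j) hx₁
  obtain ⟨t, ht0, htR, ht⟩ := hR x₁ hx₁.1 _ (L.shift_mem_base hx i).1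
  have htc : shift t x₁ ∈ L.base n := ⟨X.mapsTo t hx₁.1, (L.isLevel n).mem_of_agree _ _
    (ht.mono (by have : (0 : ℤ) ≤ m * L.p n := by positivity
                 omega)) (L.shift_mem_base hx i).2⟩
  obtain ⟨s, rfl⟩ := L.dvd_of_shift_mem_base hx₁' htc
  have hw : word (code hx) i m = word (code hx₁') s m := by
    rw [word_eq_word_iff]
    intro k hk0 hk
    rw [code_eq_code_iff]
    intro r hr0 hr
    have h1 : k * (L.p n : ℤ) + r ≤ m * L.p n := by nlinarith
    have h2 : 0 ≤ k * (L.p n : ℤ) + r := by positivity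
    have := ht (k * L.p n + r) (by omega) (by omega)
    rw [shift_apply, shift_apply] at this
    convert this using 2 <;> ring
  rw [hw]
  have hs : 0 ≤ s := nonneg_of_mul_nonneg_right ht0 (by exact_mod_cast hp)
  refine word_infix_word _ hs ?_
  obtain ⟨s, rfl⟩ := Int.eq_ofNat_of_zero_le hs
  have hle : n + j ≤ L.p (n + j) := L.strictMono_p.id_le _
  have : s + m ≤ L.p (n + j) / L.p n := by
    rw [Nat.le_div_iff_mul_le hp, add_mul, mul_comm s]
    have : L.p n * s ≤ R := by exact_mod_cast htR
    omega
  omega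

/-- The abstract subshift $X^{(n)}$ is the base of level $n$, read in blocks. One inclusion uses
that the base is closed, the other that every window recurs in all blocks of some higher level. -/
theorem mem_level_iff (hX : IsMinimalSubshift X) {n : ℕ} {y : ℤ → L.Letter n} :
    y ∈ ((L.directive hne hF).level n).carrier ↔ ∃ x, ∃ hx : x ∈ L.base n, code hx = y := by
  have hp : (0 : ℤ) < L.p n := by exact_mod_cast L.p_pos n
  constructor
  · intro hy
    have key : ∀ N : ℕ, ∃ x, ∃ hx : x ∈ L.base n, ∀ i : ℤ, -N ≤ i → i < N → code hx i = y i := by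
      intro N
      obtain ⟨w, ⟨j, -, a, hw⟩, hyw⟩ := hy (-N) (2 * N)
      obtain ⟨x, hx, rfl⟩ := exists_code_eq a
      rw [comp_code] at hw
      obtain ⟨i, hi⟩ := exists_eq_word_of_infix (hyw.trans hw)
      rw [length_word, word_eq_word_iff] at hi
      refine ⟨_, L.shift_mem_base (L.base_subset (Nat.le_add_right n j) hx) (i + N),
        fun k h1 h2 => ?_⟩
      have := hi (k + N) (by omega) (by push_cast; omega)
      rw [code_shift (L.base_subset (Nat.le_add_right n j) hx), add_assoc, add_comm (N : ℤ), ← this]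
      congr 1
      ring
    -- The letters of $y$, written out one after the other with the block of index $0$ starting at
    -- the origin.
    let x : ℤ → ℤ := fun t => (y (t / L.p n)).1 ⟨(t % L.p n).toNat, by
      have h1 := Int.emod_nonneg t hp.ne'
      have h2 := Int.emod_lt_of_pos t hp
      omega⟩
    have hval : ∀ (x' : ℤ → ℤ) (hx' : x' ∈ L.base n) (t : ℤ),
        code hx' (t / L.p n) = y (t / L.p n) → x' t = x t := by
      intro x' hx' t ht
      simp only [x, ← ht, code]
      rw [Int.toNat_of_nonneg (Int.emod_nonneg t hp.ne'), mul_comm, Int.mul_ediv_add_emod]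
    have hx : x ∈ L.base n := by
      rw [base, ← (L.isLevel n).isClosed.closure_eq, mem_closure_iff_agree]
      intro N
      obtain ⟨x', hx', h⟩ := key (N.natAbs + 1)
      refine ⟨x', hx', fun t h1 h2 => (hval x' hx' t (h _ ?_ ?_)).symm⟩
      · rw [Int.le_ediv_iff_mul_le hp]
        push_cast
        nlinarith [abs_nonneg N, neg_abs_le N, le_abs_self N]
      · rw [Int.ediv_lt_iff_lt_mul hp]
        push_cast
        nlinarith [abs_nonneg N, neg_abs_le N, le_abs_self N]
    refine ⟨x, hx, funext fun i => ?_⟩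
    obtain ⟨x', hx', h⟩ := key (i.natAbs + 1)
    have hi := h i (by omega) (by omega)
    rw [← hi, code_eq_code_iff]
    intro t h0 ht
    have hdiv : (i * L.p n + t) / L.p n = i := by
      rw [add_comm, Int.add_mul_ediv_right _ _ hp.ne', Int.ediv_eq_zero_of_lt h0 ht, zero_add]
    exact (hval x' hx' _ (by rw [hdiv, hi])).symm
  · rintro ⟨x, hx, rfl⟩ i m
    obtain ⟨j, hj, h⟩ := exists_word_infix_comp hne hF hX n m
    obtain ⟨a⟩ := (L.directive hne hF).instNonempty (n + j)
    exact ⟨_, ⟨j, hj, a, List.infix_refl _⟩, h x hx i a⟩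

theorem length_subst (n : ℕ) (a : L.Letter (n + 1)) :
    (L.subst n a).length = L.p (n + 1) / L.p n := by
  rw [subst, length_word]

theorem primitive_directive (hX : IsMinimalSubshift X) : (L.directive hne hF).Primitive := by
  intro n
  obtain ⟨j, hj, h⟩ := exists_word_infix_comp hne hF hX n 1
  refine ⟨j, hj, fun b a => ?_⟩
  obtain ⟨x, hx, rfl⟩ := exists_code_eq b
  have := h x hx 0 a
  rw [word_one] at this
  exact this.subset (List.mem_singleton_self _)

/-- The right half of the common window is the first letter of every image. The left half, read at
the next return $S^{p_{n+1}}x$ to the base, is the last letter. -/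
theorem proper_directive : (L.directive hne hF).Proper := by
  intro n
  obtain ⟨w, hw⟩ := L.window n
  obtain ⟨x₀, hx₀⟩ := L.base_nonempty hne (n + 1)
  have hx₀' := L.base_succ_subset n hx₀
  have hp := L.p_pos n
  obtain ⟨l, hl⟩ := L.p_dvd hne (Nat.le_succ n)
  rw [Nat.succ_eq_add_one] at hl
  have hl' : L.p (n + 1) / L.p n = l := by rw [hl, Nat.mul_div_cancel_left _ hp]
  have hlpos : 0 < l := by rw [← hl']; exact Nat.div_pos (L.lt n).le hp
  refine ⟨code hx₀' 0, code hx₀' (-1), fun a => ?_⟩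
  obtain ⟨x, hx, rfl⟩ := exists_code_eq a
  have hx' := L.base_succ_subset n hx
  change (L.subst n _).head? = _ ∧ (L.subst n _).getLast? = _
  rw [subst_code hne, hl', zero_mul]
  constructor
  · obtain ⟨k, rfl⟩ : ∃ k, l = 1 + k := ⟨l - 1, by omega⟩
    rw [word_add, word_one, List.singleton_append, List.head?_cons, Option.some_inj,
      code_eq_code_iff]
    intro t h0 ht
    rw [zero_mul, zero_add, hw x hx.1 hx.2 t (by omega) ht, hw x₀ hx₀.1 hx₀.2 t (by omega) ht]
  · obtain ⟨k, rfl⟩ : ∃ k, l = k + 1 := ⟨l - 1, by omega⟩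
    rw [word_add, word_one, List.getLast?_append, List.getLast?_singleton, Option.some_or,
      Option.some_inj, code_eq_code_iff]
    intro t h0 ht
    have h1 := L.shift_mem_base hx 1
    have h2 := hw _ h1.1 h1.2 (-L.p n + t) (by omega) (by omega)
    rw [shift_apply, one_mul, hl] at h2
    rw [neg_one_mul, hw x₀ hx₀.1 hx₀.2 (-L.p n + t) (by omega) (by omega), ← h2]
    congr 1
    push_cast
    ring

/-- Two representations give two points of the base of level $n + 1$ that differ by a shift of
$(k'-k)p_n$. This is a multiple of $p_{n+1}$ of smaller absolute value, hence $0$. -/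
theorem recognizable_directive (hX : IsMinimalSubshift X) :
    (L.directive hne hF).Recognizable := by
  intro n x y y' k k' hy hy' hk hk'
  have hp := L.p_pos n
  obtain ⟨l, hl⟩ := L.p_dvd hne (Nat.le_succ n)
  rw [Nat.succ_eq_add_one] at hl
  have hl' : L.p (n + 1) / L.p n = l := by rw [hl, Nat.mul_div_cancel_left _ hp]
  have hlpos : 0 < (l : ℤ) := by
    rw [← hl']
    exact_mod_cast Nat.div_pos (L.lt n).le hp
  obtain ⟨x₁, hx₁, rfl⟩ := (mem_level_iff hne hF hX).1 hy
  obtain ⟨x₂, hx₂, rfl⟩ := (mem_level_iff hne hF hX).1 hy'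
  have himage : ∀ {x₁ : ℤ → ℤ} (hx₁ : x₁ ∈ L.base (n + 1)) {z : ℤ → L.Letter n},
      IsImage (L.subst n) (code hx₁) z → z = code (L.base_succ_subset n hx₁) := by
    intro x₁ hx₁ z hz
    funext t
    have h1 := Int.emod_nonneg t hlpos.ne'
    have h2 := Int.emod_lt_of_pos t hlpos
    have h3 := hz (t / l) (t % l).toNat (by rw [length_subst, hl']; omega)
    rw [cut_of_constant_length (fun a => (length_subst n a).trans hl')] at h3
    simp only [subst_code hne, getElem_word, hl', Int.toNat_of_nonneg h1] at h3
    rwa [mul_comm, Int.mul_ediv_add_emod] at h3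
  obtain ⟨⟨z, hz, rfl⟩, hk0, hkl⟩ := hk
  obtain ⟨⟨z', hz', hzz'⟩, hk0', hkl'⟩ := hk'
  obtain rfl := himage hx₁ hz
  obtain rfl := himage hx₂ hz'
  have e := eq_of_code_eq (L.base_succ_subset n hx₁) (L.base_succ_subset n hx₂) k k'
    (fun i => congrFun hzz' i)
  have hkl1 : k < l := hkl.trans_eq (by rw [← hl']; exact_mod_cast length_subst n _)
  have hkl2 : k' < l := hkl'.trans_eq (by rw [← hl']; exact_mod_cast length_subst n _)
  have e' : x₁ = shift ((k' - k) * L.p n) x₂ := by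
    have := congrArg (shift (-(k * L.p n))) e
    rw [shift_shift, shift_shift, neg_add_cancel, shift_zero] at this
    rw [this]
    congr 1
    ring
  have hd := L.dvd_of_shift_mem_base hx₂ (e' ▸ hx₁)
  rw [hl] at hd
  push_cast at hd
  rw [mul_comm] at hd
  have hd' : (l : ℤ) ∣ k' - k :=
    Int.dvd_of_mul_dvd_mul_right (by exact_mod_cast hp.ne') hd
  have hkk : k' - k = 0 :=
    Int.eq_zero_of_abs_lt_dvd hd' (by rw [abs_lt]; constructor <;> omega)
  refine ⟨?_, by omega⟩
  rw [hkk, zero_mul, shift_zero] at e'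
  subst e'
  rfl

theorem alphabetRank_directive_le : (L.directive hne hF).alphabetRank ≤ (2 : ℕ) := by
  refine Filter.liminf_le_of_frequently_le' (Filter.Eventually.frequently ?_)
  -- Level $0$ carries the original alphabet, which may be larger; the two-block bound starts at
  -- level $1$.
  filter_upwards [Filter.eventually_ge_atTop 1] with n hn
  obtain ⟨n, rfl⟩ : ∃ k, n = k + 1 := ⟨n - 1, by omega⟩
  obtain ⟨u, v, huv⟩ := L.block n
  let _ : Fintype (L.Letter (n + 1)) := (L.directive hne hF).instFintype (n + 1)
  have h : Fintype.card (L.Letter (n + 1)) ≤ Fintype.card Bool := by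
    classical
    refine Fintype.card_le_of_injective
      (fun a : L.Letter (n + 1) => decide (∀ i, a.1 i = u (i : ℕ))) fun a b hab => ?_
    have hcase : ∀ a : L.Letter (n + 1), (∀ i, a.1 i = u (i : ℕ)) ∨ ∀ i, a.1 i = v (i : ℕ) := by
      rintro ⟨f, x, hx, hf⟩
      have hi : ∀ i : Fin (L.p (n + 1)), ((i : ℕ) : ℤ) < L.p (n + 1) :=
        fun i => by exact_mod_cast i.2
      exact (huv x hx.1 hx.2).imp (fun h i => (hf i).trans (h _ (by omega) (hi i)))
        (fun h i => (hf i).trans (h _ (by omega) (hi i)))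
    rw [decide_eq_decide] at hab
    apply Subtype.ext
    funext i
    rcases hcase a with ha | ha
    · rw [ha, hab.1 ha]
    · rcases hcase b with hb | hb
      · rw [hb, hab.2 hb]
      · rw [ha, hb]
  rw [Fintype.card_bool] at h
  exact_mod_cast h

/-- Level $0$ has period $1$ and base $X$, so coding merely renames the letters. -/
theorem conjugate_directive (hX : IsMinimalSubshift X) :
    Conjugate (shiftHomeo X) (shiftHomeo (L.directive hne hF).subshift) := by
  have hcs : CompactSpace X.carrier := isCompact_iff_compactSpace.1 (isCompact_carrier hF)
  have hb : ∀ x : X.carrier, x.1 ∈ L.base 0 := fun x => by rw [L.base_zero]; exact x.2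
  let f : X.carrier → (L.directive hne hF).subshift.carrier :=
    fun x => ⟨code (hb x), (mem_level_iff hne hF hX).2 ⟨_, hb x, rfl⟩⟩
  have hf : Function.Bijective f := by
    constructor
    · intro x y hxy
      have := eq_of_code_eq (hb x) (hb y) 0 0
        (fun i => congrFun (congrArg Subtype.val hxy) (0 + i))
      apply Subtype.ext
      simpa using this
    · rintro ⟨y, hy⟩
      obtain ⟨x, hx, rfl⟩ := (mem_level_iff hne hF hX).1 hy
      exact ⟨⟨x, hx.1⟩, rfl⟩
  have hcont : Continuous f := by
    refine Continuous.subtype_mk (continuous_pi fun i => ?_) _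
    refine IsLocallyConstant.continuous ((IsLocallyConstant.iff_eventually_eq _).2 fun x => ?_)
    have h1 : {y : X.carrier | Agree |i| x.1 y.1} ∈ nhds x :=
      ((isOpen_agree _ _).preimage continuous_subtype_val).mem_nhds fun _ _ _ => rfl
    filter_upwards [h1] with y hy
    rw [code_eq_code_iff, L.p_zero]
    intro t h0 ht
    obtain rfl : t = 0 := by push_cast at ht; omega
    simpa using (hy i (neg_abs_le i) (le_abs_self i)).symm
  refine ⟨Continuous.homeoOfEquivCompactToT2 (f := Equiv.ofBijective f hf) hcont, fun x => ?_⟩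
  apply Subtype.ext
  funext i
  change code (hb _) i = code (hb x) (1 + i)
  rw [code_eq_code_iff, L.p_zero]
  intro t _ _
  exact congrArg x.1 (by push_cast; ring)

theorem isStrongToeplitz (L : LevelSequence X) (hX : IsMinimalSubshift X)
    (hne : X.carrier.Nonempty) {F : Finset ℤ} (hF : ∀ x ∈ X.carrier, ∀ i, x i ∈ F) :
    IsStrongToeplitz 2 X :=
  ⟨L.directive hne hF, fun n => ⟨_, length_subst n⟩, primitive_directive hne hF hX,
    proper_directive hne hF, recognizable_directive hne hF hX, alphabetRank_directive_le hne hF,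
    conjugate_directive hne hF hX⟩

end LevelSequence

/-! ### A Toeplitz sequence over two letters -/

/-- The Toeplitz sequence which fills the positions `≡ 40` modulo `100` with itself and the other
ones with the indicator of `{10, 20}` modulo `100`. -/
def skeleton (i : ℤ) : Bool :=
  if _h : i % 100 = 40 then skeleton (i / 100) else decide (i % 100 = 10 ∨ i % 100 = 20)
termination_by i.natAbs
decreasing_by omega

theorem skeleton_of_emod_eq {i : ℤ} (h : i % 100 = 40) : skeleton i = skeleton (i / 100) := by
  rw [skeleton, dif_pos h]

theorem skeleton_of_emod_ne {i : ℤ} (h : i % 100 ≠ 40) :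
    skeleton i = decide (i % 100 = 10 ∨ i % 100 = 20) := by
  rw [skeleton, dif_neg h]

/-- This is all that isolation and avoidance need: the cyclic gaps between $10, 20, 40$ modulo $100$
are $10, 20, 70$, so two steps of $20$ and then $10$ never fit. -/
theorem emod_of_skeleton {i : ℤ} (h : skeleton i = true) :
    i % 100 = 10 ∨ i % 100 = 20 ∨ i % 100 = 40 := by
  by_cases h40 : i % 100 = 40
  · exact Or.inr (Or.inr h40)
  · rw [skeleton_of_emod_ne h40, decide_eq_true_eq] at h
    tauto

theorem skeleton_eq_true {i : ℤ} (h : i % 100 = 10 ∨ i % 100 = 20) : skeleton i = true := by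
  rw [skeleton_of_emod_ne (by omega), decide_eq_true_eq]
  exact h

theorem skeleton_eq_false {i : ℤ} (h10 : i % 100 ≠ 10) (h20 : i % 100 ≠ 20)
    (h40 : i % 100 ≠ 40) : skeleton i = false := by
  by_contra h
  have := emod_of_skeleton (Bool.not_eq_false _ ▸ h)
  omega

/-! ### Sequences coded by the Toeplitz sequence -/

/-- `y` arises from the Toeplitz sequence by replacing the letters by distinct words `B true` and
`B false` of length `P`. -/
structure IsCoded (P : ℕ) (B : Bool → ℤ → ℤ) (y : ℤ → ℤ) : Prop where
  pos : 0 < P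
  ne : ∃ j : ℤ, 0 ≤ j ∧ j < P ∧ B true j ≠ B false j
  eq : ∀ i, y i = B (skeleton (i / P)) (i % P)

namespace IsCoded

variable {P : ℕ} {B : Bool → ℤ → ℤ} {y : ℤ → ℤ}

theorem apply_mul_add (h : IsCoded P B y) (k : ℤ) {r : ℤ} (h0 : 0 ≤ r) (hr : r < P) :
    y (k * P + r) = B (skeleton k) r := by
  have hP : (P : ℤ) ≠ 0 := by exact_mod_cast h.pos.ne'
  rw [h.eq, add_comm, Int.add_mul_ediv_right _ _ hP, Int.ediv_eq_zero_of_lt h0 hr, zero_add,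
    Int.add_mul_emod_self_right, Int.emod_eq_of_lt h0 hr]

/-- Self-similarity: a run of $100$ letters of the skeleton is fixed except at its place $40$, where
the skeleton itself reappears. The two new words differ exactly through the old words at that place.
-/
theorem next (h : IsCoded P B y) : ∃ B', IsCoded (100 * P) B' y := by
  have hP : (0 : ℤ) < P := by exact_mod_cast h.pos
  refine ⟨fun b j => B (if j / P = 40 then b else skeleton (j / P)) (j % P), ?_, ?_, ?_⟩
  · have := h.pos
    omega
  · obtain ⟨j, h0, hj, hne⟩ := h.ne
    refine ⟨40 * P + j, by positivity, by push_cast; omega, ?_⟩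
    have h1 : (40 * (P : ℤ) + j) / P = 40 := by
      rw [add_comm, Int.add_mul_ediv_right _ _ hP.ne', Int.ediv_eq_zero_of_lt h0 hj, zero_add]
    have h2 : (40 * (P : ℤ) + j) % P = j := by
      rw [add_comm, Int.add_mul_emod_self_right, Int.emod_eq_of_lt h0 hj]
    simpa only [h1, h2, if_true] using hne
  · intro i
    have h1 : i / ((100 * P : ℕ) : ℤ) = i / P / 100 := by
      rw [Int.ediv_ediv_of_nonneg hP.le]
      congr 1
      push_cast
      ring
    have h2 : i % ((100 * P : ℕ) : ℤ) = (i / P % 100) * P + i % P := by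
      rw [Int.emod_def, h1, Int.emod_def (i / P), Int.emod_def i P]
      push_cast
      ring
    have h3 := Int.emod_nonneg i hP.ne'
    have h4 := Int.emod_lt_of_pos i hP
    have h5 : ((i / P % 100) * P + i % P) / P = i / P % 100 := by
      rw [add_comm, Int.add_mul_ediv_right _ _ hP.ne', Int.ediv_eq_zero_of_lt h3 h4, zero_add]
    have h6 : ((i / P % 100) * P + i % P) % P = i % P := by
      rw [add_comm, Int.add_mul_emod_self_right, Int.emod_eq_of_lt h3 h4]
    simp only [h1, h2, h5, h6]
    rw [h.eq i]
    congr 1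
    split_ifs with h40
    · rw [skeleton_of_emod_eq h40]
    · rw [skeleton_of_emod_ne h40, skeleton_of_emod_ne (by omega), Int.emod_emod]

theorem exists_le (h : IsCoded P B y) (q : ℕ) : ∃ P' B', q ≤ P' ∧ IsCoded P' B' y := by
  induction q with
  | zero => exact ⟨P, B, Nat.zero_le _, h⟩
  | succ q ih =>
    obtain ⟨P', B', hq, h'⟩ := ih
    obtain ⟨B'', h''⟩ := h'.next
    have := h'.pos
    exact ⟨_, B'', by omega, h''⟩

/-- Around multiples of `100 P`, the sequence is constant on windows of length `2 P`. -/
theorem apply_near_mul (h : IsCoded P B y) (k : ℤ) {i : ℤ} (h0 : -P ≤ i) (hi : i < P) :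
    y (k * (100 * P : ℕ) + i) = B false (i % P) := by
  have hP : (0 : ℤ) < P := by exact_mod_cast h.pos
  have h1 : (k * (100 * P : ℕ) + i) / P = 100 * k + i / P := by
    rw [show k * ((100 * P : ℕ) : ℤ) + i = i + (100 * k) * P by push_cast; ring,
      Int.add_mul_ediv_right _ _ hP.ne', add_comm]
  have h2 : (k * (100 * P : ℕ) + i) % P = i % P := by
    rw [show k * ((100 * P : ℕ) : ℤ) + i = i + (100 * k) * P by push_cast; ring,
      Int.add_mul_emod_self_right]
  have h3 : -1 ≤ i / P := (Int.le_ediv_iff_mul_le hP).2 (by omega)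
  have h4 : i / P < 1 := (Int.ediv_lt_iff_lt_mul hP).2 (by omega)
  rw [h.eq, h1, h2, skeleton_eq_false (by omega) (by omega) (by omega)]

theorem exists_common_period (h : IsCoded P B y) (N : ℕ) :
    ∃ p : ℕ, 0 < p ∧ ∀ i k : ℤ, -N ≤ i → i ≤ N → y (k * p + i) = y i := by
  obtain ⟨P', B', hN, h'⟩ := h.exists_le (N + 1)
  refine ⟨100 * P', by have := h'.pos; omega, fun i k h1 h2 => ?_⟩
  have h3 := h'.apply_near_mul k (i := i) (by omega) (by omega)
  have h4 := h'.apply_near_mul 0 (i := i) (by omega) (by omega)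
  rw [zero_mul, zero_add] at h4
  rw [h3, h4]

theorem isBlock (h : IsCoded P B y) (k : ℤ) : IsBlock P (B (skeleton k)) (shift (k * P) y) :=
  fun _ h0 hi => h.apply_mul_add k h0 hi

theorem isBlock_true_iff (h : IsCoded P B y) (k : ℤ) :
    IsBlock P (B true) (shift (k * P) y) ↔ skeleton k = true := by
  refine ⟨fun hb => ?_, fun hk => hk ▸ h.isBlock k⟩
  by_contra hk
  obtain ⟨j, h0, hj, hne⟩ := h.ne
  have h1 := h.isBlock k j h0 hj
  rw [Bool.eq_false_of_not_eq_true hk] at h1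
  exact hne ((hb j h0 hj).symm.trans h1)

end IsCoded

/-- The position `t` is a defect of the period `P`, and the `P` positions before it are not. -/
def IsFirstDefect (P : ℕ) (x : ℤ → ℤ) (t : ℤ) : Prop :=
  x t ≠ x (t + P) ∧ ∀ l : ℤ, 0 < l → l ≤ P → x (t - l) = x (t - l + P)

theorem IsFirstDefect.shift_iff {P : ℕ} {x : ℤ → ℤ} {k t : ℤ} :
    IsFirstDefect P (shift k x) t ↔ IsFirstDefect P x (k + t) := by
  simp only [IsFirstDefect, shift_apply, ← add_assoc, add_sub_assoc]

theorem IsFirstDefect.of_agree {P : ℕ} {x y : ℤ → ℤ} {t N : ℤ} (h : IsFirstDefect P x t)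
    (hxy : Agree N x y) (h1 : -N + P ≤ t) (h2 : t + P ≤ N) : IsFirstDefect P y t := by
  refine ⟨?_, fun l h0 hl => ?_⟩
  · rw [← hxy _ (by omega) (by omega), ← hxy _ (by omega) (by omega)]
    exact h.1
  · rw [← hxy _ (by omega) (by omega), ← hxy _ (by omega) (by omega)]
    exact h.2 l h0 hl

namespace IsCoded

variable {P : ℕ} {B : Bool → ℤ → ℤ} {y : ℤ → ℤ}

/-- The first defects lie in a single residue class modulo `P` and occur with bounded gaps. -/
theorem exists_firstDefect (h : IsCoded P B y) : ∃ j₀ : ℤ,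
    (∀ t, IsFirstDefect P y t → (P : ℤ) ∣ t - j₀) ∧
      ∀ s : ℤ, ∃ t : ℤ, s ≤ t ∧ t ≤ s + 200 * P ∧ IsFirstDefect P y t := by
  classical
  have hP : (0 : ℤ) < P := by exact_mod_cast h.pos
  -- The first place where the two words differ; every change of letter in the skeleton first shows
  -- there.
  obtain ⟨j₀, hj0, hjP, hjne, hjmin⟩ : ∃ j₀ : ℤ, 0 ≤ j₀ ∧ j₀ < P ∧ B true j₀ ≠ B false j₀ ∧
      ∀ j, 0 ≤ j → j < j₀ → B true j = B false j := by
    have hex : ∃ n : ℕ, n < P ∧ B true n ≠ B false n := by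
      obtain ⟨j, h0, hj, hne⟩ := h.ne
      exact ⟨j.toNat, by omega, by rwa [Int.toNat_of_nonneg h0]⟩
    refine ⟨Nat.find hex, by omega, by exact_mod_cast (Nat.find_spec hex).1,
      (Nat.find_spec hex).2, fun j h0 hj => ?_⟩
    have := Nat.find_min hex (m := j.toNat) (by omega)
    have hlt := (Nat.find_spec hex).1
    by_contra hne
    exact this ⟨by omega, by rwa [Int.toNat_of_nonneg h0]⟩
  have hBne : ∀ b b' : Bool, b ≠ b' → B b j₀ ≠ B b' j₀ := by
    rintro (_ | _) (_ | _) hb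
    · exact absurd rfl hb
    · exact hjne.symm
    · exact hjne
    · exact absurd rfl hb
  have hBeq : ∀ b b' : Bool, ∀ j, 0 ≤ j → j < j₀ → B b j = B b' j := by
    rintro (_ | _) (_ | _) j h0 hj
    · rfl
    · exact (hjmin j h0 hj).symm
    · exact hjmin j h0 hj
    · rfl
  have hnext : ∀ (k : ℤ) {r : ℤ}, 0 ≤ r → r < P → y (k * P + r + P) = B (skeleton (k + 1)) r := by
    intro k r h0 hr
    rw [← h.apply_mul_add (k + 1) h0 hr]
    congr 1
    ring
  refine ⟨j₀, fun t ht => ?_, fun s => ?_⟩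
  · have h3 := Int.emod_nonneg t hP.ne'
    have h4 := Int.emod_lt_of_pos t hP
    have h5 : t = t / P * P + t % P := by rw [mul_comm, Int.mul_ediv_add_emod]
    set k := t / P
    set r := t % P
    have h6 := ht.1
    rw [h5, h.apply_mul_add k h3 h4, hnext k h3 h4] at h6
    have hk : skeleton k ≠ skeleton (k + 1) := fun hk => h6 (by rw [hk])
    have hr0 : j₀ ≤ r := by
      by_contra hlt
      exact h6 (hBeq _ _ r h3 (by omega))
    -- A defect later in the block is preceded, less than $P$ positions earlier, by the defect at
    -- $j_0$.
    have hr : r = j₀ := by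
      by_contra hne
      have h7 := ht.2 (r - j₀) (by omega) (by omega)
      rw [show t - (r - j₀) = k * P + j₀ by omega, h.apply_mul_add k hj0 hjP,
        hnext k hj0 hjP] at h7
      exact hBne _ _ hk h7
    exact ⟨k, by rw [mul_comm]; omega⟩
  · set a := s / (100 * P)
    have h100 : (0 : ℤ) < 100 * P := by positivity
    have ha : s = 100 * P * a + s % (100 * P) := (Int.mul_ediv_add_emod _ _).symm
    have ha0 := Int.emod_nonneg s h100.ne'
    have ha1 := Int.emod_lt_of_pos s h100
    -- The letters at $8, 9, 10$ modulo $100$ are false, false, true: no defect from block $8$ to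
    -- block $9$, then one from $9$ to $10$.
    have hk8 : skeleton (100 * (a + 1) + 8) = false :=
      skeleton_eq_false (by omega) (by omega) (by omega)
    have hk9 : skeleton (100 * (a + 1) + 9) = false :=
      skeleton_eq_false (by omega) (by omega) (by omega)
    have hk10 : skeleton (100 * (a + 1) + 9 + 1) = true := skeleton_eq_true (by omega)
    have hmul : (100 * (a + 1) + 9) * (P : ℤ) = 100 * P * a + 109 * P := by ring
    refine ⟨(100 * (a + 1) + 9) * P + j₀, by omega, by omega, ?_, fun l h0 hl => ?_⟩
    · rw [h.apply_mul_add _ hj0 hjP, hnext _ hj0 hjP, hk9, hk10]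
      exact hBne _ _ (by simp)
    · by_cases hlj : l ≤ j₀
      · rw [add_sub_assoc, h.apply_mul_add _ (by omega) (by omega),
          hnext _ (by omega) (by omega)]
        exact hBeq _ _ _ (by omega) (by omega)
      · rw [show (100 * (a + 1) + 9) * (P : ℤ) + j₀ - l = (100 * (a + 1) + 8) * P + (P + j₀ - l) by
          ring, h.apply_mul_add _ (by omega) (by omega), hnext _ (by omega) (by omega), hk8,
          show 100 * (a + 1) + 8 + 1 = 100 * (a + 1) + 9 by ring, hk9]

end IsCoded

/-! ### Orbit closures -/

/-- The orbit closure of a sequence. -/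
def orbitClosure (y : ℤ → ℤ) : Subshift ℤ ℤ where
  carrier := closure (orbit y)
  isClosed := isClosed_closure
  mapsTo g := by
    refine Set.MapsTo.closure ?_ (continuous_shift g)
    rintro _ ⟨k, rfl⟩
    exact ⟨g + k, by simp only [shift_shift]⟩

theorem mem_orbitClosure_iff {x y : ℤ → ℤ} :
    x ∈ (orbitClosure y).carrier ↔ ∀ N, ∃ k, Agree N x (shift k y) := by
  change x ∈ closure (orbit y) ↔ _
  simp only [mem_closure_iff_agree, orbit, Set.exists_range_iff]

theorem shift_mem_orbitClosure (y : ℤ → ℤ) (k : ℤ) : shift k y ∈ (orbitClosure y).carrier :=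
  subset_closure ⟨k, rfl⟩

/-- A limit $x$ of shifts of $y$ sees, within every $p$ consecutive positions, a shift by a multiple
of $p$, hence a copy of the central window of $y$. So $y$ lies in the orbit closure of $x$. -/
theorem isMinimal_orbitClosure {y : ℤ → ℤ}
    (h : ∀ N : ℕ, ∃ p : ℕ, 0 < p ∧ ∀ i k : ℤ, -N ≤ i → i ≤ N → y (k * p + i) = y i) :
    IsMinimalSubshift (orbitClosure y) := by
  intro x hx
  refine Set.Subset.antisymm (closure_minimal ?_ (orbitClosure y).isClosed)
    (closure_minimal ?_ isClosed_closure)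
  · rintro _ ⟨k, rfl⟩
    exact (orbitClosure y).mapsTo k hx
  · have hy : y ∈ (orbitClosure x).carrier := by
      rw [mem_orbitClosure_iff]
      intro N
      obtain ⟨p, hp, hper⟩ := h N.natAbs
      obtain ⟨t, ht⟩ := mem_orbitClosure_iff.1 hx (N + p)
      have hp' : (0 : ℤ) < p := by exact_mod_cast hp
      have h1 := Int.emod_nonneg (-t) hp'.ne'
      have h2 := Int.emod_lt_of_pos (-t) hp'
      have h3 := Int.mul_ediv_add_emod (-t) p
      refine ⟨-t % p, fun i hi1 hi2 => ?_⟩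
      rw [shift_apply, ht _ (by omega) (by omega), shift_apply,
        ← hper i (-(-t / p)) (by omega) (by omega)]
      congr 1
      linear_combination -h3
    rintro _ ⟨k, rfl⟩
    exact (orbitClosure x).mapsTo k hy

/-- A closed base of a periodic partition of a compact subshift is given by a local rule. -/
theorem exists_isLevel_of_isClosed {X : Subshift ℤ ℤ} (hc : IsCompact X.carrier) {P : ℕ}
    (hP : 0 < P) {C : Set (ℤ → ℤ)} (hC : IsClosed C)
    (hCX : C ⊆ X.carrier) (hcover : ∀ x ∈ X.carrier, ∃ i : ℤ, 0 ≤ i ∧ i < P ∧ shift i x ∈ C)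
    (hshift : ∀ x ∈ C, shift (P : ℤ) x ∈ C)
    (hdisj : ∀ x ∈ C, ∀ i : ℤ, 0 < i → i < P → shift i x ∉ C) :
    ∃ m c, IsLevel X P m c ∧ ∀ x ∈ X.carrier, x ∈ c ↔ x ∈ C := by
  -- The points in the other classes of the partition form a compact set disjoint from $C$. A window
  -- separating the two makes agreement with a point of $C$ a local test for membership.
  let K : Set (ℤ → ℤ) := X.carrier ∩ ⋃ i ∈ Set.Ioo (0 : ℤ) P, shift i ⁻¹' C
  have hK : IsCompact K := hc.inter_right
    ((Set.finite_Ioo _ _).isClosed_biUnion fun i _ => hC.preimage (continuous_shift i))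
  obtain ⟨m, hm⟩ := exists_forall_not_agree ((hc.of_isClosed_subset hC hCX).prod hK) (by
    rintro ⟨x, y⟩ ⟨hx, -, hy⟩ (hxy : x = y)
    subst hxy
    simp only [Set.mem_iUnion] at hy
    obtain ⟨i, hi, hiC⟩ := hy
    exact hdisj _ hx i hi.1 hi.2 hiC)
  have hiff : ∀ x ∈ X.carrier, x ∈ {x | ∃ z ∈ C, Agree m z x} ↔ x ∈ C := by
    intro x hx
    refine ⟨?_, fun hxC => ⟨x, hxC, fun _ _ _ => rfl⟩⟩
    rintro ⟨z, hz, hzx⟩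
    obtain ⟨i, h0, hi, hiC⟩ := hcover x hx
    rcases h0.eq_or_lt with rfl | h0
    · rwa [shift_zero] at hiC
    · refine absurd hzx (hm (z, x) ⟨hz, hx, ?_⟩)
      exact Set.mem_biUnion (show i ∈ Set.Ioo (0 : ℤ) P from ⟨h0, hi⟩) hiC
  refine ⟨m, _, ⟨hP, ?_, ?_, ?_, ?_⟩, hiff⟩
  · rintro x y hxy ⟨z, hz, hzx⟩
    exact ⟨z, hz, hzx.trans hxy⟩
  · intro x hx
    obtain ⟨i, h0, hi, hiC⟩ := hcover x hx
    exact ⟨i, h0, hi, (hiff _ (X.mapsTo i hx)).2 hiC⟩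
  · intro x hx hxc
    exact (hiff _ (X.mapsTo _ hx)).2 (hshift x ((hiff x hx).1 hxc))
  · intro x hx hxc i h0 hi hic
    exact hdisj x ((hiff x hx).1 hxc) i h0 hi ((hiff _ (X.mapsTo i hx)).1 hic)

/-- The base is the closure of the shifts of $y$ by multiples of $P$. First defects make the phase
modulo $P$ visible in a bounded window, which keeps the translates of the closure disjoint. -/
theorem IsCoded.exists_isLevel {P : ℕ} {B : Bool → ℤ → ℤ} {y : ℤ → ℤ} (h : IsCoded P B y)
    (hc : IsCompact (orbitClosure y).carrier) :
    ∃ m c, IsLevel (orbitClosure y) P m c ∧ (∀ k : ℤ, shift (k * P) y ∈ c) ∧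
      ∀ x ∈ (orbitClosure y).carrier, x ∈ c → ∀ N, ∃ k : ℤ, Agree N x (shift (k * P) y) := by
  have hP : (0 : ℤ) < P := by exact_mod_cast h.pos
  let C : Set (ℤ → ℤ) := closure (Set.range fun k : ℤ => shift (k * P) y)
  have hCmem : ∀ {x}, x ∈ C ↔ ∀ N, ∃ k : ℤ, Agree N x (shift (k * P) y) := by
    intro x
    simp only [C, mem_closure_iff_agree, Set.exists_range_iff]
  have hCk : ∀ k : ℤ, shift (k * P) y ∈ C := fun k => subset_closure ⟨k, rfl⟩
  obtain ⟨j₀, hj₀, hdef⟩ := h.exists_firstDefect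
  have hCdef : ∀ x ∈ C, ∀ t, IsFirstDefect P x t → (P : ℤ) ∣ t - j₀ := by
    intro x hx t ht
    obtain ⟨k, hk⟩ := hCmem.1 hx (|t| + P)
    have h1 := ht.of_agree hk (by have := neg_abs_le t; omega) (by have := le_abs_self t; omega)
    rw [IsFirstDefect.shift_iff] at h1
    have h2 := hj₀ _ h1
    rwa [add_sub_assoc, dvd_add_right (Dvd.intro_left k rfl)] at h2
  have hCX : C ⊆ (orbitClosure y).carrier :=
    closure_minimal (by rintro _ ⟨k, rfl⟩; exact shift_mem_orbitClosure y _)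
      (orbitClosure y).isClosed
  have hcover : ∀ x ∈ (orbitClosure y).carrier, ∃ i : ℤ, 0 ≤ i ∧ i < P ∧ shift i x ∈ C := by
    intro x hx
    have hsub : (orbitClosure y).carrier ⊆ ⋃ i ∈ Set.Ico (0 : ℤ) P, shift i ⁻¹' C := by
      refine closure_minimal ?_
        ((Set.finite_Ico _ _).isClosed_biUnion fun i _ => isClosed_closure.preimage
          (continuous_shift i))
      rintro _ ⟨k, rfl⟩
      refine Set.mem_biUnion (show -k % P ∈ Set.Ico (0 : ℤ) P from
        ⟨Int.emod_nonneg _ hP.ne', Int.emod_lt_of_pos _ hP⟩) ?_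
      have := hCk (-(-k / P))
      rw [Set.mem_preimage]
      dsimp only
      rw [shift_shift]
      convert this using 2
      linear_combination Int.mul_ediv_add_emod (-k) P
    simpa [and_assoc] using hsub hx
  have hshift : ∀ x ∈ C, shift (P : ℤ) x ∈ C := by
    intro x hx
    rw [hCmem] at hx ⊢
    intro N
    obtain ⟨k, hk⟩ := hx (N + P)
    refine ⟨k + 1, ?_⟩
    have := hk.shift (M := N) (k := P) (by rw [abs_of_pos hP])
    rw [shift_shift] at this
    convert this using 2
    ring
  have hdisj : ∀ x ∈ C, ∀ i : ℤ, 0 < i → i < P → shift i x ∉ C := by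
    intro x hx i h0 hi hiC
    -- The window is wide enough to contain a first defect, found within $200P$, with its
    -- neighbourhood of size $P$.
    obtain ⟨s, hs⟩ := mem_orbitClosure_iff.1 (hCX hx) (300 * P)
    obtain ⟨t, ht1, ht2, ht⟩ := hdef s
    have hxt : IsFirstDefect P x (t - s) := by
      refine IsFirstDefect.of_agree ?_ hs.symm (by omega) (by omega)
      rw [IsFirstDefect.shift_iff]
      convert ht using 1
      ring
    have h1 := hCdef x hx _ hxt
    have h2 := hCdef _ hiC (t - s - i) (by
      rw [IsFirstDefect.shift_iff]
      convert hxt using 1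
      ring)
    have h3 : (P : ℤ) ∣ i := by
      rw [show i = t - s - j₀ - (t - s - i - j₀) by ring]
      exact dvd_sub h1 h2
    exact absurd (Int.le_of_dvd h0 h3) (by omega)
  obtain ⟨m, c, hlevel, hiff⟩ := exists_isLevel_of_isClosed hc h.pos isClosed_closure hCX hcover
    hshift hdisj
  exact ⟨m, c, hlevel, fun k => (hiff _ (shift_mem_orbitClosure y _)).2 (hCk k),
    fun x hx hxc => hCmem.1 ((hiff x hx).1 hxc)⟩

theorem IsCoded.hasAsymmetricLevel {P : ℕ} {B : Bool → ℤ → ℤ} {y : ℤ → ℤ} (h : IsCoded P B y)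
    (hc : IsCompact (orbitClosure y).carrier) (q : ℕ) : HasAsymmetricLevel q (orbitClosure y) := by
  -- Two scales are used: blocks of length $P_1 \ge q$ supply the window shared near multiples of
  -- $P_2 = 100 P_1$, and $P_2$ is the period of the level.
  obtain ⟨P₁, B₁, hq, h₁⟩ := h.exists_le q
  obtain ⟨B₂, h₂⟩ := h₁.next
  obtain ⟨m, c, hlevel, hmem, hagree⟩ := h₂.exists_isLevel hc
  set P₂ := 100 * P₁ with hP₂
  have hpos := h₁.pos
  have hblock : ∀ (x : ℤ → ℤ) (k j : ℤ), 0 ≤ j → j ≤ 30 → Agree (40 * P₂) x (shift (k * P₂) y) →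
      (IsBlock P₂ (B₂ true) (shift (j * P₂) x) ↔ skeleton (k + j) = true) := by
    intro x k j h0 hj hk
    rw [← h₂.isBlock_true_iff, show (k + j) * (P₂ : ℤ) = j * P₂ + k * P₂ by ring, ← shift_shift]
    have h1 : (0 : ℤ) ≤ j * P₂ := by positivity
    have h2 : j * (P₂ : ℤ) + P₂ ≤ 40 * P₂ := by nlinarith
    exact ⟨fun hb => hb.of_agree hk h1 h2, fun hb => hb.of_agree hk.symm h1 h2⟩
  have hblock0 : ∀ (x : ℤ → ℤ) (k : ℤ), Agree (40 * P₂) x (shift (k * P₂) y) →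
      (IsBlock P₂ (B₂ true) x ↔ skeleton k = true) := by
    intro x k hk
    simpa using hblock x k 0 le_rfl (by norm_num) hk
  refine ⟨P₂, m, c, B₂ false, B₂ true, fun i => B₁ false (i % P₁), hlevel, by omega, ?_, ?_, ?_,
    ?_, ?_⟩
  · intro x hx hxc i h1 h2
    obtain ⟨k, hk⟩ := hagree x hx hxc q
    rw [hk i h1 h2.le, shift_apply]
    exact h₁.apply_near_mul k (by omega) (by omega)
  · intro x hx hxc
    obtain ⟨k, hk⟩ := hagree x hx hxc (40 * P₂)
    have hb := h₂.isBlock k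
    have hb' : IsBlock P₂ (B₂ (skeleton k)) x := by
      have := IsBlock.of_agree (k := 0) (by simpa using hb) hk.symm le_rfl (by omega)
      simpa using this
    cases hsk : skeleton k
    · exact Or.inl (hsk ▸ hb')
    · exact Or.inr (hsk ▸ hb')
  · intro x hx hxc hv j h0 hj hjv
    obtain ⟨k, hk⟩ := hagree x hx hxc (40 * P₂)
    rw [hblock0 x k hk] at hv
    rw [hblock x k j h0.le (by omega) hk] at hjv
    have h1 := emod_of_skeleton hv
    have h2 := emod_of_skeleton hjv
    omega
  -- At $1010$, $1020$, $1040$ the skeleton is true; the last position has residue $40$ and quotient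
  -- $10$, where the skeleton is true.
  · refine ⟨_, shift_mem_orbitClosure y _, hmem 1010, ?_, ?_, ?_⟩
    · rw [hblock0 _ 1010 fun _ _ _ => rfl]
      exact skeleton_eq_true (by norm_num)
    · rw [hblock _ 1010 10 (by norm_num) (by norm_num) fun _ _ _ => rfl]
      exact skeleton_eq_true (by norm_num)
    · rw [hblock _ 1010 30 (by norm_num) (by norm_num) fun _ _ _ => rfl,
        skeleton_of_emod_eq (by norm_num)]
      exact skeleton_eq_true (by norm_num)
  · rintro x hx hxc ⟨hv0, hv1, hv2⟩
    obtain ⟨k, hk⟩ := hagree x hx hxc (40 * P₂)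
    rw [hblock0 x k hk] at hv0
    rw [hblock x k 20 (by norm_num) (by norm_num) hk] at hv1
    rw [hblock x k 30 (by norm_num) (by norm_num) hk] at hv2
    have h0 := emod_of_skeleton hv0
    have h1 := emod_of_skeleton hv1
    have h2 := emod_of_skeleton hv2
    omega

/-- A level of period $p$ provides $p$ distinct shifts of a point, and $p \ge q$ is unbounded. -/
theorem infinite_of_hasAsymmetricLevel {X : Subshift ℤ ℤ} (hG : ∀ q, HasAsymmetricLevel q X) :
    X.carrier.Infinite := by
  intro hfin
  obtain ⟨p, m, c, u, v, w, h⟩ := hG (hfin.toFinset.card + 1)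
  obtain ⟨x, hx, hxc, -⟩ := h.occurs
  have hle := h.le
  have : (Finset.range p).card ≤ hfin.toFinset.card := by
    refine Finset.card_le_card_of_injOn (fun i : ℕ => shift (i : ℤ) x)
      (fun i _ => by simpa using X.mapsTo (i : ℤ) hx) ?_
    intro i hi j hj hij
    have h1 : shift ((i : ℤ) - j) x = x := by
      have := congrArg (shift (-j : ℤ)) hij
      simp only [shift_shift, neg_add_cancel, shift_zero] at this
      rw [← this]
      congr 1
      ring
    have h2 := (h.shift_mem_iff hx hxc ((i : ℤ) - j)).1 (by rwa [h1])
    simp only [Finset.coe_range, Set.mem_Iio] at hi hj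
    have h3 := Int.eq_zero_of_abs_lt_dvd h2 (by rw [abs_lt]; constructor <;> omega)
    omega
  rw [Finset.card_range] at this
  omega

/-! ### Density -/

theorem finite_of_common_period {X : Subshift ℤ ℤ} {F : Finset ℤ}
    (hF : ∀ x ∈ X.carrier, ∀ i, x i ∈ F) {e : ℕ} (he : 0 < e)
    (hper : ∀ x ∈ X.carrier, ∀ i : ℤ, x (i + e) = x i) : X.carrier.Finite := by
  have he' : (0 : ℤ) < e := by exact_mod_cast he
  have hmod : ∀ x ∈ X.carrier, ∀ i : ℤ, x i = x (i % e) := by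
    intro x hx i
    have hp : Function.Periodic x (e : ℤ) := hper x hx
    have := hp.int_mul (i / e) (i % e)
    rw [← this]
    congr 1
    push_cast
    rw [mul_comm, Int.emod_add_mul_ediv]
  refine Set.Finite.of_finite_image (f := fun x (j : Fin e) => x (j : ℕ)) ?_ ?_
  · refine (Set.Finite.pi' fun _ : Fin e => F.finite_toSet).subset ?_
    rintro _ ⟨x, hx, rfl⟩ j
    exact hF x hx _
  · intro x hx y hy hxy
    funext i
    have h1 := Int.emod_nonneg i he'.ne'
    have h2 := Int.emod_lt_of_pos i he'
    have h3 := congrFun hxy ⟨(i % e).toNat, by omega⟩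
    simp only [Int.toNat_of_nonneg h1] at h3
    rw [hmod x hx, hmod y hy, h3]

/-- The word `x[0, e)` followed by a prefix of `x[0, ∞)`. -/
def joinAt (x : ℤ → ℤ) (e j : ℤ) : ℤ := if j < e then x j else x (j - e)

/-- An infinite minimal subshift has two return times to a word of length `n` whose return words
do not commute and which contain all words of length `n`. -/
theorem exists_noncommuting_returns {X : Subshift ℤ ℤ} (hX : IsMinimalSubshift X)
    (hinf : X.carrier.Infinite) {F : Finset ℤ} (hF : ∀ x ∈ X.carrier, ∀ i, x i ∈ F) (n : ℕ) :
    ∃ x ∈ X.carrier, ∃ e f : ℕ, n < e ∧ n < f ∧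
      (∀ i : ℤ, 0 ≤ i → i < n → x (e + i) = x i) ∧ (∀ i : ℤ, 0 ≤ i → i < n → x (f + i) = x i) ∧
      (∃ j : ℤ, 0 ≤ j ∧ j < e + f ∧ joinAt x f j ≠ joinAt x e j) ∧
      ∀ w ∈ lang X n, ∃ t : ℤ, 0 ≤ t ∧ t < e ∧ w = word x t n := by
  have hc := isCompact_carrier hF
  obtain ⟨x, hx⟩ := hinf.nonempty
  obtain ⟨R, hR⟩ := hX.exists_recurrence hc n
  have hret : ∀ T : ℕ, ∃ e : ℕ, T ≤ e ∧ ∀ i : ℤ, 0 ≤ i → i < n → x (e + i) = x i := by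
    intro T
    obtain ⟨t, h0, -, ht⟩ := hR _ (X.mapsTo (T : ℤ) hx) x hx
    refine ⟨T + t.toNat, by omega, fun i h1 h2 => ?_⟩
    rw [ht i (by omega) (by omega), shift_shift, shift_apply]
    congr 1
    push_cast
    omega
  obtain ⟨e, he, hret_e⟩ := hret (R + n + 1)
  have hf : ∃ f : ℕ, n < f ∧ (∀ i : ℤ, 0 ≤ i → i < n → x (f + i) = x i) ∧
      ∃ j : ℤ, 0 ≤ j ∧ j < e + f ∧ joinAt x f j ≠ joinAt x e j := by
    by_contra! hcon
    -- If $x[0,e)$ commuted with arbitrarily long return words, $x[0,\infty)$ would have period $e$;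
    -- by minimality so would all of $X$, which would then be finite.
    have hper : ∀ i : ℤ, 0 ≤ i → x (i + e) = x i := by
      intro i h0
      obtain ⟨f, hf, hret_f⟩ := hret (i.toNat + e + n + 1)
      have h1 := hcon f (by omega) hret_f (i + e) (by omega) (by omega)
      rwa [joinAt, joinAt, if_pos (by omega), if_neg (by omega), add_sub_cancel_right] at h1
    refine hinf (finite_of_common_period hF (e := e) (by omega) fun y hy i => ?_)
    obtain ⟨R', hR'⟩ := hX.exists_recurrence hc e
    obtain ⟨t, h0, -, ht⟩ := hR' x hx _ (X.mapsTo i hy)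
    have h1 := ht 0 (by omega) (by omega)
    have h2 := ht e (by omega) le_rfl
    rw [shift_apply, shift_apply, add_zero, add_zero] at h1
    rw [shift_apply, shift_apply] at h2
    rw [h1, h2, hper t h0]
  obtain ⟨f, hf, hret_f, hne⟩ := hf
  refine ⟨x, hx, e, f, by omega, hf, hret_e, hret_f, hne, ?_⟩
  rintro _ ⟨y, hy, i, rfl⟩
  obtain ⟨t, h0, htR, ht⟩ := hR x hx _ (X.mapsTo i hy)
  refine ⟨t, h0, by omega, ?_⟩
  rw [word_eq_word_iff]
  exact fun k h1 h2 => ht k (by omega) (by omega)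

/-- Every return word is followed by a word that starts with $x[0,n)$, as in $x$ itself. So a window
of length $n$ that starts inside a return word continues as in $x$, across block boundaries too. -/
theorem exists_hasAsymmetricLevel_lang_eq (X : M) (n : ℕ) :
    ∃ Y : M, (∀ q, HasAsymmetricLevel q Y.1.1) ∧ lang X.1.1 n = lang Y.1.1 n := by
  obtain ⟨⟨X, F, hF⟩, hinf, hX⟩ := X
  obtain ⟨x, hx, e, f, hne, hnf, hret_e, hret_f, hdiff, hcov⟩ :=
    exists_noncommuting_returns hX hinf hF n
  -- With $a = x[0,e)$ and $b = x[0,f)$, false is coded by $ab$ and true by $ba$, both of length $e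
  -- + f$.
  let B : Bool → ℤ → ℤ := fun b => joinAt x (if b then f else e : ℕ)
  let y : ℤ → ℤ := fun i => B (skeleton (i / (e + f : ℕ))) (i % (e + f : ℕ))
  have hy : IsCoded (e + f) B y := by
    refine ⟨by omega, ?_, fun i => rfl⟩
    obtain ⟨j, h0, hj, hj'⟩ := hdiff
    exact ⟨j, h0, by push_cast; omega, by simpa [B] using hj'⟩
  have hyF : ∀ i, y i ∈ F := by
    intro i
    simp only [y, B, joinAt]
    split_ifs <;> exact hF x hx _
  have hYF : ∀ z ∈ (orbitClosure y).carrier, ∀ i, z i ∈ F := by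
    intro z hz i
    obtain ⟨k, hk⟩ := mem_orbitClosure_iff.1 hz |i|
    rw [hk i (neg_abs_le i) (le_abs_self i)]
    exact hyF _
  have hc := isCompact_carrier hYF
  have hG := hy.hasAsymmetricLevel hc
  -- a window which starts in the first return word of a block
  have hfirst : ∀ k r : ℤ, 0 ≤ r → r < (if skeleton k then f else e : ℕ) → ∀ i : ℤ, 0 ≤ i →
      i < n → y (k * (e + f : ℕ) + r + i) = x (r + i) := by
    intro k r h0 hr i hi0 hi
    have hlt : r + i < (e + f : ℕ) := by
      push_cast
      split_ifs at hr <;> omega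
    rw [add_assoc, hy.apply_mul_add k (by omega) hlt]
    simp only [B, joinAt]
    split_ifs at hr ⊢ with hk hlt
    · rfl
    · rw [← hret_f _ (by omega) (by omega)]
      congr 1
      ring
    · rfl
    · rw [← hret_e _ (by omega) (by omega)]
      congr 1
      ring
  -- a window which starts in the second return word of a block
  have hsecond : ∀ k r : ℤ, (if skeleton k then f else e : ℕ) ≤ r → r < (e + f : ℕ) →
      ∀ i : ℤ, 0 ≤ i → i < n → y (k * (e + f : ℕ) + r + i) =
        x (r - (if skeleton k then f else e : ℕ) + i) := by
    intro k r h0 hr i hi0 hi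
    by_cases hlt : r + i < (e + f : ℕ)
    · rw [add_assoc, hy.apply_mul_add k (by omega) hlt]
      simp only [B, joinAt]
      rw [if_neg (by omega)]
      congr 1
      ring
    · have h1 : y (k * (e + f : ℕ) + r + i) = y ((k + 1) * (e + f : ℕ) + (r + i - (e + f : ℕ))) := by
        congr 1
        ring
      push_cast at hlt hr
      rw [h1, hy.apply_mul_add (k + 1) (by push_cast; omega) (by push_cast; omega)]
      simp only [B, joinAt]
      rw [if_pos (by push_cast; split_ifs <;> omega)]
      split_ifs with hk
      · rw [← hret_e _ (by push_cast; omega) (by push_cast; omega)]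
        congr 1
        push_cast
        ring
      · rw [← hret_f _ (by push_cast; omega) (by push_cast; omega)]
        congr 1
        push_cast
        ring
  have hwindow : ∀ s : ℤ, ∃ t : ℤ, ∀ i : ℤ, 0 ≤ i → i < n → y (s + i) = x (t + i) := by
    intro s
    have hpos : (0 : ℤ) < (e + f : ℕ) := by push_cast; omega
    have h1 := Int.emod_nonneg s hpos.ne'
    have h2 := Int.emod_lt_of_pos s hpos
    have h3 : s = s / (e + f : ℕ) * (e + f : ℕ) + s % (e + f : ℕ) := by
      rw [mul_comm, Int.mul_ediv_add_emod]
    by_cases hlt : s % (e + f : ℕ) < (if skeleton (s / (e + f : ℕ)) then f else e : ℕ)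
    · exact ⟨_, fun i h0 hi => by
        rw [h3]
        exact hfirst _ _ h1 hlt i h0 hi⟩
    · exact ⟨_, fun i h0 hi => by
        rw [h3]
        exact hsecond _ _ (not_lt.1 hlt) h2 i h0 hi⟩
  refine ⟨⟨⟨orbitClosure y, F, hYF⟩, infinite_of_hasAsymmetricLevel hG,
    isMinimal_orbitClosure hy.exists_common_period⟩, hG, ?_⟩
  apply Set.Subset.antisymm
  · intro w hw
    obtain ⟨t, h0, ht, rfl⟩ := hcov w hw
    refine ⟨shift 0 y, shift_mem_orbitClosure y 0, t, ?_⟩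
    rw [shift_zero, word_eq_word_iff]
    intro i hi0 hi
    -- The block at the origin is thus $ab$, and all words of length $n$ start within its first $e$
    -- positions.
    have hs : skeleton 0 = false := skeleton_eq_false (by norm_num) (by norm_num) (by norm_num)
    have := hfirst 0 t h0 (by simpa [hs] using ht) i hi0 hi
    rw [zero_mul, zero_add] at this
    exact this.symm
  · rintro _ ⟨z, hz, i, rfl⟩
    obtain ⟨k, hk⟩ := mem_orbitClosure_iff.1 hz (|i| + n)
    obtain ⟨t, ht⟩ := hwindow (k + i)
    refine ⟨x, hx, t, ?_⟩
    rw [word_eq_word_iff]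
    intro j h0 hj
    rw [hk (i + j) (by have := neg_abs_le i; omega) (by have := le_abs_self i; omega), ← ht j h0 hj,
      shift_apply, add_assoc]

/-! ### Generic subshifts -/

theorem isStrongToeplitz_of_hasAsymmetricLevel (X : M) (hG : ∀ q, HasAsymmetricLevel q X.1.1) :
    IsStrongToeplitz 2 X.1.1 ∧ IsToeplitz X.1.1 ∧ ¬ ConjugateToInverse X.1.1 := by
  obtain ⟨⟨X, F, hF⟩, hinf, hX⟩ := X
  obtain ⟨L⟩ := exists_levelSequence hinf.nonempty hG
  exact ⟨L.isStrongToeplitz hX hinf.nonempty hF,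
    L.isToeplitz hX (isCompact_carrier hF) hinf.nonempty,
    not_conjugateToInverse hX (isCompact_carrier hF) hG⟩

theorem isGδ_forall_hasAsymmetricLevel : IsGδ {X : M | ∀ q, HasAsymmetricLevel q X.1.1} := by
  rw [Set.ofPred_forall]
  exact IsGδ.iInter_of_isOpen isOpen_hasAsymmetricLevel

theorem dense_forall_hasAsymmetricLevel : Dense {X : M | ∀ q, HasAsymmetricLevel q X.1.1} :=
  dense_of_lang exists_hasAsymmetricLevel_lang_eq

end ToeplitzShift

end

theorem mainTheorem6 :
    ToeplitzShift.IsGeneric {X : ToeplitzShift.M |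
        ToeplitzShift.IsStrongToeplitz 2 X.1.1 ∧ ¬ ToeplitzShift.ConjugateToInverse X.1.1} ∧
      ToeplitzShift.IsGeneric {X : ToeplitzShift.M |
        ToeplitzShift.IsToeplitz X.1.1 ∧ ¬ ToeplitzShift.ConjugateToInverse X.1.1} ∧
      IsMeagre {X : ToeplitzShift.M |
        ToeplitzShift.IsToeplitz X.1.1 ∧ ToeplitzShift.ConjugateToInverse X.1.1} := by
  have hGδ := ToeplitzShift.isGδ_forall_hasAsymmetricLevel
  have hdense := ToeplitzShift.dense_forall_hasAsymmetricLevel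
  have hmem := ToeplitzShift.isStrongToeplitz_of_hasAsymmetricLevel
  refine ⟨⟨_, fun X hX => ?_, hGδ, hdense⟩, ⟨_, fun X hX => ?_, hGδ, hdense⟩, ?_⟩
  · exact ⟨(hmem X hX).1, (hmem X hX).2.2⟩
  · exact (hmem X hX).2
  -- Meagreness means that the complement is residual, and the complement contains the dense
  -- $G_\delta$ set.
  · exact Filter.mem_of_superset (residual_of_dense_Gδ hGδ hdense)
      fun X hX h => (hmem X hX).2.2 h.2
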